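/- Let $n\in\mathbb N$, $s\in(0,1)$, $0<\lambda\le\Lambda$, and let $\omega:[0,\infty)\to[0,\infty)$ be a concave modulus of continuity (so $\omega(0)=0$ and $\omega(t)\to0$ as $t\downarrow0$). **Kernels.** Consider measurable $K:\mathbb R^n\times\mathbb R^n\to\mathbb R$ with $K(x,y)=K(x,-y)$ and $\lambda|y|^{-n-2s}\le K(x,y)\le\Lambda|y|^{-n-2s}$ for $y\ne0$, and set $$\mathcal L_xu(x)=\tfrac12\int_{\mathbb R^n}\big(2u(x)-u(x+y)-u(x-y)\big)K(x,y)\,dy .$$ Write $\mathcal L_x\in\mathfrak L^\omega_s(\lambda,\Lambda)$ if moreover $\int_{B_{2r}\setminus B_r}|K(x,y)-K(x',y)|\,dy\le\omega(|x-x'|)\,r^{-2s}$ for all $x,x'\in\mathbb R^n$, $r>0$. For $\mu>0$ and $m=\lceil\mu-1\rceil$, let $[K]^x_\mu$ be the best constant $C$ such that $K(\cdot,y)\in C^m(\mathbb R^n)$ for $y\neq 0$ and $\int_{B_{2r}\setminus B_r}|D_x^mK(x,y)-D_x^mK(x',y)|\,dy\le C|x-x'|^{\mu-m}r^{-2s}$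 for all $x,x'\in\mathbb R^n$, $r>0$ (with $[K]^x_\mu=\infty$ if there is none). **Operators.** $\mathfrak I^\omega_s(\lambda,\Lambda)$ is the class of operators $$\mathcal I(u,x)=\inf_{b\in\mathcal B}\sup_{a\in\mathcal A}\{-\mathcal L_{ab,x}u(x)+c_{ab}(x)\}$$ with $\mathcal L_{ab,x}\in\mathfrak L^\omega_s(\lambda,\Lambda)$, $|c_{ab}(x)-c_{ab}(x')|\le\omega(|x-x'|)$ for all $a,b,x,x'$, and $\mathcal I(0,\cdot)\in L^\infty(\mathbb R^n)$. $\mathfrak I^\infty_s(\lambda,\Lambda)$ is the class of those $\mathcal I\in\mathfrak I^\omega_s(\lambda,\Lambda)$ with kernels $K_{ab}$ such that $\sup_{a,b}[K_{ab}]^x_\mu<\infty$ for every $\mu>0$. **Mollifiers.** Let $\varphi\in C^\infty_c(B_1)$ be radial and nonnegative with $\int\varphi=1$, and let $\varphi_\varepsilon(x)=\varepsilon^{-n}\varphi(x/\varepsilon)$ for $\varepsilon>0$. **Proposition.** Let $\mathcal I\in\mathfrak I^\omega_s(\lambda,\Lambda)\cap\mathfrak I^\infty_s(\lambda,\Lambda)$,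 let $\delta>0$ and $f\in C(B_1)$, and let $u\in C^{2s+\delta}_{\rm loc}(B_1)\cap C^\delta_c(\mathbb R^n)$ satisfy $\mathcal I(u,x)=f(x)$ for all $x\in B_1$. (Here $C^\beta$ means: $\lceil\beta-1\rceil$ continuous bounded derivatives, the last of which is Hölder continuous of order $\beta-\lceil\beta-1\rceil\in(0,1]$.) Then there are operators $\mathcal I_\varepsilon\in\mathfrak I^\omega_s(\lambda,\Lambda)\cap\mathfrak I^\infty_s(\lambda,\Lambda)$ and functions $f_\varepsilon\in C^\infty(B_1)$, for $\varepsilon>0$, such that $u_\varepsilon:=u*\varphi_\varepsilon\in C^\infty_c(\mathbb R^n)$ satisfies $$\mathcal I_\varepsilon(u_\varepsilon,x)=f_\varepsilon(x)\quad\text{for all }x\in B_1,\ \varepsilon>0,$$ and, as $\varepsilon\downarrow0$, $f_\varepsilon\to f$ and $\mathcal I_\varepsilon(0,\cdot)\to\mathcal I(0,\cdot)$ uniformly in $B_{3/4}$. -/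

import Mathlib

open scoped Topology

universe v w

noncomputable section

namespace NonlocalApprox

/-- The Euclidean space `ℝⁿ`. -/
abbrev Rn (n : ℕ) := EuclideanSpace ℝ (Fin n)

/-! ### Moduli of continuity, kernels and linear operators -/

/-- `ω : [0, ∞) → [0, ∞)` is a (concave) modulus of continuity; only its values on `[0, ∞)` are used.
Being nonnegative and concave on `[0, ∞)`, such an `ω` is automatically nondecreasing. -/
structure IsModulus (ω : ℝ → ℝ) : Prop where
  nonneg : ∀ t, 0 ≤ t → 0 ≤ ω t
  zero : ω 0 = 0
  tendsto_zero : Filter.Tendsto ω (𝓝[>] 0) (𝓝 0)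
  concave : ConcaveOn ℝ (Set.Ici 0) ω

/-- The dyadic annulus `B_{2r} \ B_r` centred at the origin. -/
def annulus (n : ℕ) (r : ℝ) : Set (Rn n) := Metric.ball 0 (2 * r) \ Metric.ball 0 r

/-- The linear operator with (symmetric) kernel `K`,
`𝓛ₓ u(x) = ½ ∫ (2 u(x) - u(x+y) - u(x-y)) K(x,y) dy`. -/
def linOp {n : ℕ} (K : Rn n → Rn n → ℝ) (u : Rn n → ℝ) (x : Rn n) : ℝ :=
  (1 / 2) * ∫ y, (2 * u x - u (x + y) - u (x - y)) * K x y

/-- Measurable kernels, even in `y`, comparable to the kernel of the fractional Laplacian. The point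
`y = 0`, where the bounds are infinite, is left out. -/
structure IsEllipticKernel {n : ℕ} (s lam Lam : ℝ) (K : Rn n → Rn n → ℝ) : Prop where
  measurable : Measurable (Function.uncurry K)
  symm : ∀ x y, K x y = K x (-y)
  lower : ∀ x y, y ≠ 0 → lam / ‖y‖ ^ ((n : ℝ) + 2 * s) ≤ K x y
  upper : ∀ x y, y ≠ 0 → K x y ≤ Lam / ‖y‖ ^ ((n : ℝ) + 2 * s)

/-- `∫_{B_{2r} \ B_r} |K(x,y) - K(x',y)| dy ≤ ω(|x-x'|) / r^{2s}` for all `x, x'` and `r > 0`. -/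
def HasModulusX {n : ℕ} (s : ℝ) (ω : ℝ → ℝ) (K : Rn n → Rn n → ℝ) : Prop :=
  ∀ (x x' : Rn n) (r : ℝ), 0 < r →
    ∫⁻ y in annulus n r, ‖K x y - K x' y‖ₑ ≤ ENNReal.ofReal (ω ‖x - x'‖ / r ^ (2 * s))

/-- The class `𝔏^ω_s(λ, Λ)`, in terms of the kernel. -/
def MemLOmega {n : ℕ} (s lam Lam : ℝ) (ω : ℝ → ℝ) (K : Rn n → Rn n → ℝ) : Prop :=
  IsEllipticKernel s lam Lam K ∧ HasModulusX s ω K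

/-- The integer `m = ⌈μ - 1⌉`, for `μ > 0`, so that `μ - m ∈ (0, 1]`. -/
def holderOrder (μ : ℝ) : ℕ := ⌈μ - 1⌉₊

/-- With `m = ⌈μ - 1⌉`: the kernel has `m` continuous derivatives in `x`, and
`∫_{B_{2r} \ B_r} |Dₓᵐ K(x,y) - Dₓᵐ K(x',y)| dy ≤ C |x-x'|^{μ-m} / r^{2s}` for all `x, x'`, `r > 0`;
that is, `[K]^x_μ ≤ C`. -/
def HolderXBound {n : ℕ} (s μ C : ℝ) (K : Rn n → Rn n → ℝ) : Prop :=
  (∀ y, y ≠ 0 → ContDiff ℝ (holderOrder μ) (fun x => K x y)) ∧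
  ∀ (x x' : Rn n) (r : ℝ), 0 < r →
    ∫⁻ y in annulus n r,
        ‖iteratedFDeriv ℝ (holderOrder μ) (fun z => K z y) x -
          iteratedFDeriv ℝ (holderOrder μ) (fun z => K z y) x'‖ₑ
      ≤ ENNReal.ofReal (C * ‖x - x'‖ ^ (μ - holderOrder μ) / r ^ (2 * s))

/-! ### Fully nonlinear operators -/

/-- The data of a fully nonlinear operator of inf-sup form: index sets, kernels `K_{ab}`, and zero
order terms `c_{ab}`. -/
structure InfSupOp (n : ℕ) where
  A : Type v
  B : Type w
  K : A → B → Rn n → Rn n → ℝ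
  c : A → B → Rn n → ℝ

/-- `𝓘(u, x) = inf_b sup_a { -𝓛_{ab,x} u(x) + c_{ab}(x) }`. The infimum and the suprema are taken in
the extended reals. -/
def InfSupOp.eval {n : ℕ} (I : InfSupOp n) (u : Rn n → ℝ) (x : Rn n) : EReal :=
  ⨅ b : I.B, ⨆ a : I.A, ((-linOp (I.K a b) u x + I.c a b x : ℝ) : EReal)

/-- The class `𝔍^ω_s(λ, Λ)`. Since the `c_{ab}` share the modulus `ω`, `𝓘(0, ·)` is essentially
bounded if and only if it is bounded (in particular finite) at every point. -/
structure MemIOmega {n : ℕ} (s lam Lam : ℝ) (ω : ℝ → ℝ) (I : InfSupOp n) : Prop where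
  kernel : ∀ a b, MemLOmega s lam Lam ω (I.K a b)
  modulus : ∀ a b x x', |I.c a b x - I.c a b x'| ≤ ω ‖x - x'‖
  bounded : ∃ M : ℝ, ∀ x, ((-M : ℝ) : EReal) ≤ I.eval (fun _ => 0) x ∧
    I.eval (fun _ => 0) x ≤ (M : EReal)

/-- The class `𝔍^μ_s(λ, Λ)`: operators in `𝔍^ω_s(λ, Λ)` with `sup_{ab} [K_{ab}]^x_μ < ∞`. -/
def MemIMu {n : ℕ} (s lam Lam : ℝ) (ω : ℝ → ℝ) (μ : ℝ) (I : InfSupOp n) : Prop :=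
  MemIOmega s lam Lam ω I ∧ ∃ C : ℝ, ∀ a b, HolderXBound s μ C (I.K a b)

/-- The class `𝔍^∞_s(λ, Λ) = ⋂_{μ > 0} 𝔍^μ_s(λ, Λ)`. -/
def MemIInfty {n : ℕ} (s lam Lam : ℝ) (ω : ℝ → ℝ) (I : InfSupOp n) : Prop :=
  ∀ μ : ℝ, 0 < μ → MemIMu s lam Lam ω μ I

/-! ### Hölder spaces and mollifiers -/

/-- The Hölder space `C^β(U)` for an open set `U` and `β > 0`, with `m = ⌈β - 1⌉`: functions with `m`
continuous and bounded derivatives in `U` whose `m`-th derivative is Hölder of order `β - m`. -/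
def HolderOn {n : ℕ} (β : ℝ) (u : Rn n → ℝ) (U : Set (Rn n)) : Prop :=
  ContDiffOn ℝ (holderOrder β) u U ∧
  ∃ C : ℝ,
    (∀ k ≤ holderOrder β, ∀ x ∈ U, ‖iteratedFDeriv ℝ k u x‖ ≤ C) ∧
    ∀ x ∈ U, ∀ y ∈ U,
      ‖iteratedFDeriv ℝ (holderOrder β) u x - iteratedFDeriv ℝ (holderOrder β) u y‖
        ≤ C * ‖x - y‖ ^ (β - holderOrder β)

/-- `C^β_loc(U)`, for an open set `U`: `C^β(V)` for every open `V` compactly contained in `U`. -/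
def HolderLocOn {n : ℕ} (β : ℝ) (u : Rn n → ℝ) (U : Set (Rn n)) : Prop :=
  ∀ V : Set (Rn n), IsOpen V → IsCompact (closure V) → closure V ⊆ U → HolderOn β u V

/-- `C^β_c(ℝⁿ)`. -/
def HolderCompact {n : ℕ} (β : ℝ) (u : Rn n → ℝ) : Prop :=
  HolderOn β u Set.univ ∧ HasCompactSupport u

/-- `φ ∈ C^∞_c(B₁)` is radial, nonnegative, with integral one. -/
structure IsMollifier {n : ℕ} (φ : Rn n → ℝ) : Prop where
  smooth : ContDiff ℝ (⊤ : ℕ∞) φ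
  compact : HasCompactSupport φ
  support : tsupport φ ⊆ Metric.ball 0 1
  radial : ∀ x y, ‖x‖ = ‖y‖ → φ x = φ y
  nonneg : ∀ x, 0 ≤ φ x
  integral_eq_one : ∫ x, φ x = 1

/-- The rescaling `φ_ε(x) = ε^{-n} φ(x/ε)`. -/
def rescale {n : ℕ} (φ : Rn n → ℝ) (ε : ℝ) (x : Rn n) : ℝ := (1 / ε ^ n) * φ (ε⁻¹ • x)

/-- The mollification `u * φ_ε`. -/
def mollify {n : ℕ} (φ : Rn n → ℝ) (u : Rn n → ℝ) (ε : ℝ) : Rn n → ℝ :=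
  MeasureTheory.convolution u (rescale φ ε) (ContinuousLinearMap.lsmul ℝ ℝ) MeasureTheory.volume

end NonlocalApprox

end

/-!
The operators required by the theorem are tied to the given one only through their values at two
functions, the zero function and `u_ε = u * φ_ε`. So it is enough to show two things.

* `MemIOmega.exists_smooth_approx`: for finitely many test functions `v` and every `η > 0` there is
  an operator `J` of the class, with smooth data, such that each `J(v, ·)` is smooth and differs
  from `I(v, ·)` by at most `η` in the unit ball.
* `eventually_abs_linOp_mollify_sub_le`: `𝓛 u_ε → 𝓛 u` uniformly in `B_{3/4}` and over all linear
  operators of the class. It follows that `I(u_ε, ·) → I(u, ·) = f` uniformly there, since an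
  inf-sup depends on its entries in a nonexpansive way.

For the first one, all functions `-𝓛_{ab} v + c_{ab}` share a modulus of continuity in `x`
(`exists_abs_linOp_sub_le`). At the points of a finite net the inf-sup values are almost attained by
finitely many indices (`exists_selection`), so `min_j max_k` of a finite family `V_{jk}` of linear
operators is already close to `I(v, ·)` in the whole ball. The kernels of this finite family are
averaged in `x`, which preserves the class `𝔏^ω_s(λ, Λ)` and bounds their derivatives of every order
pointwise by multiples of `|y|^{-n-2s}`; the zero order terms are truncated and averaged. Then every
`V_{jk}` is smooth in `x`.

What is left is that a minimum of maxima of smooth functions is not smooth. It is replaced by the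
log-sum-exp expression `softMinMax`, which is smooth in its entries, and which is an exact inf-sup
of its tangent planes (`iInf_iSup_softPlane`). The slopes of these planes are convex weights, and
the classes of kernels and of zero order terms are convex, so that `softMinMax` of the family is
again an operator of the class, with the same `λ`, `Λ` and `ω`.
-/

namespace NonlocalApprox

open MeasureTheory Metric Set Filter
open scoped ENNReal NNReal Convolution

/-! ### Averaging against a bump function -/

/-- A smooth probability density on `ℝⁿ` supported in the ball of radius `ρ` about the origin. -/
structure IsBump {n : ℕ} (ψ : Rn n → ℝ) (ρ : ℝ) : Prop where
  smooth : ContDiff ℝ (⊤ : ℕ∞) ψ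
  compact : HasCompactSupport ψ
  nonneg : ∀ x, 0 ≤ ψ x
  integral_eq_one : ∫ x, ψ x = 1
  norm_lt : ∀ x, ψ x ≠ 0 → ‖x‖ < ρ

theorem IsMollifier.isBump_rescale {n : ℕ} {φ : Rn n → ℝ} (hφ : IsMollifier φ) {ε : ℝ}
    (hε : 0 < ε) : IsBump (rescale φ ε) ε := by
  have hne : ε⁻¹ ≠ 0 := inv_ne_zero hε.ne'
  refine ⟨?_, ?_, ?_, ?_, ?_⟩
  · exact contDiff_const.mul (hφ.smooth.comp (contDiff_const_smul _))
  · exact (hφ.compact.comp_smul hne).mul_left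
  · intro x
    have := hφ.nonneg (ε⁻¹ • x)
    unfold rescale
    positivity
  · unfold rescale
    rw [integral_const_mul, Measure.integral_comp_inv_smul_of_nonneg _ _ hε.le,
      hφ.integral_eq_one]
    have : ε ^ n ≠ 0 := (pow_pos hε n).ne'
    simp [this]
  · intro x hx
    have h1 : φ (ε⁻¹ • x) ≠ 0 := fun h => hx (by simp [rescale, h])
    have h2 := hφ.support (subset_tsupport _ h1)
    rw [mem_ball_zero_iff, norm_smul, norm_inv, Real.norm_of_nonneg hε.le,
      inv_mul_lt_iff₀ hε] at h2
    simpa using h2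

/-- The average of `g` about `x` with density `ψ`, that is, the convolution `g * ψ`. -/
noncomputable def smear {n : ℕ} (ψ g : Rn n → ℝ) (x : Rn n) : ℝ := ∫ z, ψ z * g (x - z)

theorem convolution_eq_smear {n : ℕ} (ψ g : Rn n → ℝ) :
    g ⋆[ContinuousLinearMap.lsmul ℝ ℝ, volume] ψ = smear ψ g := by
  funext x
  rw [convolution_lsmul_swap]
  simp [smear, mul_comm]

theorem mollify_eq_smear {n : ℕ} (φ u : Rn n → ℝ) (ε : ℝ) :
    mollify φ u ε = smear (rescale φ ε) u := convolution_eq_smear _ _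

/-- All derivatives of a convolution with a test function are bounded in terms of the sup norm of
the other factor, because every derivative can be put on the test function. -/
theorem norm_iteratedFDeriv_convolution_le {n : ℕ} {F F' : Type} [NormedAddCommGroup F]
    [NormedSpace ℝ F] [NormedAddCommGroup F'] [NormedSpace ℝ F'] [CompleteSpace F']
    (k : ℕ) (L : ℝ →L[ℝ] F →L[ℝ] F') {ψ : Rn n → F}
    (hψ : ContDiff ℝ (⊤ : ℕ∞) ψ) (hc : HasCompactSupport ψ) {g : Rn n → ℝ} {M : ℝ}
    (hg : LocallyIntegrable g) (hM : ∀ x, |g x| ≤ M) (x : Rn n) :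
    ‖iteratedFDeriv ℝ k (g ⋆[L, volume] ψ) x‖ ≤
      ‖L‖ * (M * ∫ z, ‖iteratedFDeriv ℝ k ψ z‖) := by
  induction k generalizing F F' x with
  | zero =>
    simp only [norm_iteratedFDeriv_zero]
    rw [convolution_eq_swap]
    have hint : Integrable (fun z => ‖ψ z‖) :=
      (hψ.continuous.integrable_of_hasCompactSupport hc).norm
    calc ‖∫ t, L (g (x - t)) (ψ t)‖ ≤ ∫ t, ‖L‖ * (M * ‖ψ t‖) := by
          refine norm_integral_le_of_norm_le ((hint.const_mul M).const_mul _)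
            (Eventually.of_forall fun t => ?_)
          calc ‖L (g (x - t)) (ψ t)‖ ≤ ‖L‖ * ‖g (x - t)‖ * ‖ψ t‖ := L.le_opNorm₂ _ _
            _ ≤ ‖L‖ * (M * ‖ψ t‖) := by
              rw [mul_assoc]
              gcongr
              exact hM _
      _ = _ := by rw [integral_const_mul, integral_const_mul]
  | succ k ih =>
    have h1 : fderiv ℝ (g ⋆[L, volume] ψ) =
        g ⋆[L.precompR (Rn n), volume] fderiv ℝ ψ := by
      funext y
      exact (hc.hasFDerivAt_convolution_right L hg (hψ.of_le (by exact_mod_cast le_top)) y).fderiv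
    have hM0 : 0 ≤ M := (abs_nonneg _).trans (hM 0)
    have h2 : ContDiff ℝ (⊤ : ℕ∞) (fderiv ℝ ψ) := hψ.fderiv_right (by norm_cast)
    rw [← norm_iteratedFDeriv_fderiv, h1]
    refine (ih (L.precompR (Rn n)) h2 (hc.fderiv ℝ) x).trans ?_
    simp_rw [norm_iteratedFDeriv_fderiv]
    gcongr
    exact L.norm_precompR_le (Rn n)

theorem contDiff_smear {n : ℕ} {ψ g : Rn n → ℝ} {ρ : ℝ} (hψ : IsBump ψ ρ)
    (hg : LocallyIntegrable g) : ContDiff ℝ (⊤ : ℕ∞) (smear ψ g) := by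
  rw [← convolution_eq_smear]
  exact hψ.compact.contDiff_convolution_right _ hg hψ.smooth

theorem locallyIntegrable_of_bounded {n : ℕ} {g : Rn n → ℝ} {M : ℝ} (hg : Measurable g)
    (hM : ∀ x, |g x| ≤ M) : LocallyIntegrable g :=
  (memLp_top_of_bound hg.aestronglyMeasurable M (Eventually.of_forall hM)).locallyIntegrable le_top

theorem norm_iteratedFDeriv_smear_le {n : ℕ} {ψ g : Rn n → ℝ} {ρ M : ℝ} (hψ : IsBump ψ ρ)
    (hg : Measurable g) (hM : ∀ x, |g x| ≤ M) (k : ℕ) (x : Rn n) :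
    ‖iteratedFDeriv ℝ k (smear ψ g) x‖ ≤ M * ∫ z, ‖iteratedFDeriv ℝ k ψ z‖ := by
  have hM0 : 0 ≤ M := (abs_nonneg _).trans (hM 0)
  rw [← convolution_eq_smear]
  refine (norm_iteratedFDeriv_convolution_le k _ hψ.smooth hψ.compact
    (locallyIntegrable_of_bounded hg hM) hM x).trans ?_
  exact mul_le_of_le_one_left (mul_nonneg hM0 (integral_nonneg fun _ => norm_nonneg _))
    (ContinuousLinearMap.opNorm_lsmul_le)

theorem IsBump.integrable {n : ℕ} {ψ : Rn n → ℝ} {ρ : ℝ} (hψ : IsBump ψ ρ) : Integrable ψ :=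
  hψ.smooth.continuous.integrable_of_hasCompactSupport hψ.compact

theorem IsBump.integrable_mul {n : ℕ} {ψ g : Rn n → ℝ} {ρ M : ℝ} (hψ : IsBump ψ ρ)
    (hg : Measurable g) (hM : ∀ x, |g x| ≤ M) (x : Rn n) :
    Integrable (fun z => ψ z * g (x - z)) :=
  hψ.integrable.mul_bdd (c := M) (hg.comp (measurable_const.sub measurable_id)).aestronglyMeasurable
    (Eventually.of_forall fun _ => hM _)

theorem le_smear {n : ℕ} {ψ g : Rn n → ℝ} {ρ M a : ℝ} (hψ : IsBump ψ ρ)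
    (hg : Measurable g) (hM : ∀ x, |g x| ≤ M) (x : Rn n) (ha : ∀ z, ‖z‖ < ρ → a ≤ g (x - z)) :
    a ≤ smear ψ g x := by
  calc a = ∫ z, ψ z * a := by rw [integral_mul_const, hψ.integral_eq_one, one_mul]
    _ ≤ smear ψ g x := by
      refine integral_mono (hψ.integrable.mul_const _) (hψ.integrable_mul hg hM x) fun z => ?_
      by_cases hz : ψ z = 0
      · simp [hz]
      · exact mul_le_mul_of_nonneg_left (ha z (hψ.norm_lt z hz)) (hψ.nonneg z)

theorem smear_neg {n : ℕ} (ψ g : Rn n → ℝ) (x : Rn n) :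
    smear ψ (fun z => -g z) x = -smear ψ g x := by
  simp [smear, integral_neg]

theorem smear_le {n : ℕ} {ψ g : Rn n → ℝ} {ρ M b : ℝ} (hψ : IsBump ψ ρ)
    (hg : Measurable g) (hM : ∀ x, |g x| ≤ M) (x : Rn n) (hb : ∀ z, ‖z‖ < ρ → g (x - z) ≤ b) :
    smear ψ g x ≤ b := by
  have := le_smear (a := -b) hψ hg.neg (M := M) (by simpa using hM) x
    (fun z hz => neg_le_neg (hb z hz))
  have h2 := smear_neg ψ g x
  change -b ≤ smear ψ (fun z => -g z) x at this
  linarith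

theorem abs_smear_sub_le {n : ℕ} {ψ g : Rn n → ℝ} {ρ M c η : ℝ} (hψ : IsBump ψ ρ)
    (hg : Measurable g) (hM : ∀ x, |g x| ≤ M) (x : Rn n)
    (h : ∀ z, ‖z‖ < ρ → |g (x - z) - c| ≤ η) : |smear ψ g x - c| ≤ η := by
  rw [abs_sub_le_iff]
  constructor
  · linarith [smear_le (b := c + η) hψ hg hM x
      fun z hz => by linarith [(abs_le.1 (h z hz)).2]]
  · linarith [le_smear (a := c - η) hψ hg hM x
      fun z hz => by linarith [(abs_le.1 (h z hz)).1]]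

/-! ### The singular majorant -/

/-- The kernel `|y|^{-n-2s}` of the fractional Laplacian; its value at the origin is `0`. -/
noncomputable def fracKernel (n : ℕ) (s : ℝ) (y : Rn n) : ℝ := 1 / ‖y‖ ^ ((n : ℝ) + 2 * s)

/-- The weight `min(1, |y|^p)`, which controls second differences of functions that are bounded and
regular of order `p`. -/
noncomputable def trunc {n : ℕ} (p : ℝ) (y : Rn n) : ℝ := min 1 (‖y‖ ^ p)

theorem fracKernel_nonneg {n : ℕ} (s : ℝ) (y : Rn n) : 0 ≤ fracKernel n s y := by
  unfold fracKernel
  positivity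

theorem trunc_nonneg {n : ℕ} (p : ℝ) (y : Rn n) : 0 ≤ trunc p y := by
  unfold trunc
  positivity

theorem trunc_le_one {n : ℕ} (p : ℝ) (y : Rn n) : trunc p y ≤ 1 := min_le_left _ _

theorem trunc_zero {n : ℕ} {p : ℝ} (hp : 0 < p) : trunc p (0 : Rn n) = 0 := by
  simp [trunc, Real.zero_rpow hp.ne']

theorem measurable_fracKernel {n : ℕ} (s : ℝ) : Measurable (fracKernel n s) := by
  unfold fracKernel
  fun_prop

theorem measurable_trunc {n : ℕ} (p : ℝ) : Measurable (trunc p : Rn n → ℝ) := by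
  unfold trunc
  fun_prop

theorem integrable_trunc_mul_fracKernel (n : ℕ) {s p : ℝ} (hs : 0 < s) (hp : 2 * s < p) :
    Integrable (fun y : Rn n => trunc p y * fracKernel n s y) := by
  rcases Nat.eq_zero_or_pos n with rfl | hn
  -- In dimension `0` the origin is not a null set, but the integrand vanishes there.
  · have : (fun y : Rn 0 => trunc p y * fracKernel 0 s y) = fun _ => 0 := by
      funext y
      rw [Subsingleton.elim y 0, trunc_zero (by linarith), zero_mul]
    rw [this]
    exact integrable_zero _ _ _
  have : Nonempty (Fin n) := ⟨⟨0, hn⟩⟩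
  have hfin : Module.finrank ℝ (Rn n) = n := by simp
  have key := integrable_fun_norm_addHaar (volume : Measure (Rn n))
    (f := fun r : ℝ => min 1 (r ^ p) * (1 / r ^ ((n : ℝ) + 2 * s)))
  refine key.2 ?_
  rw [hfin, ← Ioc_union_Ioi_eq_Ioi (zero_le_one' ℝ)]
  have hcast : ((n - 1 : ℕ) : ℝ) = (n : ℝ) - 1 := by
    rw [Nat.cast_sub hn]
    simp
  refine IntegrableOn.union ?_ ?_
  · have h1 : IntegrableOn (fun r : ℝ => r ^ (p - 2 * s - 1)) (Ioc 0 1) :=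
      (intervalIntegrable_iff_integrableOn_Ioc_of_le zero_le_one).1
        (intervalIntegral.intervalIntegrable_rpow' (by linarith))
    refine h1.congr_fun (fun r hr => ?_) measurableSet_Ioc
    have hr0 : 0 < r := hr.1
    have : min 1 (r ^ p) = r ^ p := min_eq_right (Real.rpow_le_one hr0.le hr.2 (by linarith))
    simp only [this, smul_eq_mul]
    rw [← Real.rpow_natCast r (n - 1), hcast, one_div, ← Real.rpow_neg hr0.le, ← Real.rpow_add hr0,
      ← Real.rpow_add hr0]
    congr 1
    ring
  · have h1 : IntegrableOn (fun r : ℝ => r ^ (-(2 * s) - 1)) (Ioi 1) :=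
      integrableOn_Ioi_rpow_of_lt (by linarith) one_pos
    refine h1.congr_fun (fun r hr => ?_) measurableSet_Ioi
    have hr1 : 1 < r := hr
    have hr0 : 0 < r := by linarith
    have : min 1 (r ^ p) = 1 := min_eq_left (Real.one_le_rpow hr1.le (by linarith))
    simp only [this, smul_eq_mul]
    rw [← Real.rpow_natCast r (n - 1), hcast, one_div, one_mul, ← Real.rpow_neg hr0.le,
      ← Real.rpow_add hr0]
    congr 1
    ring

theorem lintegral_fracKernel_annulus_le (n : ℕ) {s : ℝ} (hs : 0 < s) {C r : ℝ} (hC : 0 ≤ C)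
    (hr : 0 < r) :
    ∫⁻ y in annulus n r, ENNReal.ofReal (C * fracKernel n s y) ≤
      ENNReal.ofReal (C * (2 ^ n * volume.real (ball (0 : Rn n) 1)) / r ^ (2 * s)) := by
  have hm : MeasurableSet (annulus n r) := measurableSet_ball.diff measurableSet_ball
  calc ∫⁻ y in annulus n r, ENNReal.ofReal (C * fracKernel n s y)
      ≤ ∫⁻ y in annulus n r, ENNReal.ofReal (C * (1 / r ^ ((n : ℝ) + 2 * s))) := by
        refine setLIntegral_mono' hm fun y hy => ENNReal.ofReal_le_ofReal ?_
        have : r ≤ ‖y‖ := by simpa [annulus] using hy.2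
        unfold fracKernel
        gcongr
    _ = ENNReal.ofReal (C * (1 / r ^ ((n : ℝ) + 2 * s))) * volume (annulus n r) := by
        rw [setLIntegral_const]
    _ ≤ ENNReal.ofReal (C * (1 / r ^ ((n : ℝ) + 2 * s))) * volume (ball (0 : Rn n) (2 * r)) := by
        gcongr
        exact sdiff_subset
    _ = _ := by
        rw [Measure.addHaar_ball_of_pos _ _ (by positivity), finrank_euclideanSpace_fin,
          ← ENNReal.ofReal_toReal (measure_ball_lt_top (x := (0 : Rn n)) (r := 1)).ne,
          ← ENNReal.ofReal_mul (by positivity), ← ENNReal.ofReal_mul (by positivity)]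
        congr 1
        rw [Real.rpow_add hr, Real.rpow_natCast, mul_pow]
        have : r ^ n ≠ 0 := (pow_pos hr n).ne'
        have : r ^ (2 * s) ≠ 0 := (Real.rpow_pos_of_pos hr _).ne'
        simp only [Measure.real]
        field_simp

/-- The integral of a second difference against an elliptic kernel is small, uniformly in the
kernel, if the second difference is uniformly small and keeps a fixed decay at the origin. -/
theorem exists_abs_integral_le_of_small (n : ℕ) {s p : ℝ} (hs : 0 < s) (hp : 2 * s < p)
    (C Lam : ℝ) {η : ℝ} (hη : 0 < η) :
    ∃ σ > 0, ∀ g k : Rn n → ℝ, (∀ y, |g y| ≤ C * trunc p y) → (∀ y, |g y| ≤ σ) →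
      (∀ y, |k y| ≤ Lam * fracKernel n s y) → |∫ y, g y * k y| ≤ η := by
  have hint := integrable_trunc_mul_fracKernel n hs hp
  -- The integrals of these majorants tend to `0` as `σ → 0`, by dominated convergence.
  let F : ℝ → Rn n → ℝ := fun σ y => min (|C| * trunc p y) σ * (|Lam| * fracKernel n s y)
  have hbd : ∀ σ, 0 < σ → ∀ y, ‖F σ y‖ ≤ |C| * |Lam| * (trunc p y * fracKernel n s y) := by
    intro σ hσ y
    have h1 := trunc_nonneg p y
    have h2 := fracKernel_nonneg s y
    have h3 : 0 ≤ min (|C| * trunc p y) σ := le_min (by positivity) hσ.le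
    rw [Real.norm_of_nonneg (by positivity)]
    calc F σ y ≤ |C| * trunc p y * (|Lam| * fracKernel n s y) := by
          simp only [F]
          gcongr
          exact min_le_left _ _
      _ = _ := by ring
  have hFm : ∀ σ, AEStronglyMeasurable (F σ) := fun σ =>
    ((((measurable_trunc p).const_mul _).min measurable_const).mul
      ((measurable_fracKernel s).const_mul _)).aestronglyMeasurable
  have hlim : Tendsto (fun σ => ∫ y, F σ y) (𝓝[>] 0) (𝓝 (∫ _ : Rn n, (0 : ℝ))) := by
    refine tendsto_integral_filter_of_dominated_convergence _ (Eventually.of_forall hFm)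
      (eventually_mem_nhdsWithin.mono fun σ hσ => Eventually.of_forall (hbd σ hσ))
      (hint.const_mul _) (Eventually.of_forall fun y => ?_)
    have hc : Continuous fun σ : ℝ => F σ y :=
      (continuous_const.min continuous_id).mul continuous_const
    have h0 : F 0 y = 0 := by
      have h1 := trunc_nonneg p y
      simp only [F]
      rw [min_eq_right (by positivity), zero_mul]
    have := hc.tendsto 0
    rw [h0] at this
    exact this.mono_left nhdsWithin_le_nhds
  rw [integral_zero (α := Rn n) (G := ℝ)] at hlim
  obtain ⟨σ, hσ1, hσ0⟩ :=
    ((hlim.eventually (gt_mem_nhds hη)).and eventually_mem_nhdsWithin).exists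
  have hσ0 : 0 < σ := hσ0
  refine ⟨σ, hσ0, fun g k hg1 hg2 hk => ?_⟩
  have hFi : Integrable (F σ) := (hint.const_mul _).mono' (hFm σ) (Eventually.of_forall (hbd σ hσ0))
  rw [← Real.norm_eq_abs]
  refine (norm_integral_le_of_norm_le hFi (Eventually.of_forall fun y => ?_)).trans hσ1.le
  rw [norm_mul]
  have h1 := trunc_nonneg p y
  have h2 := fracKernel_nonneg s y
  have h3 : 0 ≤ min (|C| * trunc p y) σ := le_min (by positivity) hσ0.le
  refine mul_le_mul (le_min ((hg1 y).trans ?_) (hg2 y)) ((hk y).trans ?_) (norm_nonneg _) h3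
  · gcongr
    exact le_abs_self C
  · gcongr
    exact le_abs_self Lam

/-! ### Uniform continuity in `x` of the kernels -/

theorem lintegral_dyadic_le (n : ℕ) (g : Rn n → ℝ≥0∞) (r : ℝ) (N : ℕ) :
    ∫⁻ y in ball 0 (2 ^ N * r) \ ball 0 r, g y ≤
      ∑ k ∈ Finset.range N, ∫⁻ y in annulus n (2 ^ k * r), g y := by
  induction N with
  | zero => simp
  | succ N ih =>
    rw [Finset.sum_range_succ]
    refine le_trans ?_ (add_le_add_left ih _)
    refine le_trans (lintegral_mono_set ?_) (lintegral_union_le _ _ _)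
    intro y hy
    simp only [annulus, mem_union, Set.mem_sdiff, mem_ball_zero_iff, not_lt] at hy ⊢
    rcases lt_or_ge ‖y‖ (2 ^ N * r) with h | h
    · exact Or.inl ⟨h, hy.2⟩
    · refine Or.inr ⟨?_, h⟩
      rw [← mul_assoc, ← pow_succ']
      exact hy.1

/-- The modulus of continuity in `x` on dyadic annuli, together with the upper ellipticity bound
near the origin and at infinity, makes `x ↦ K(x, ·)` uniformly continuous in the weighted space
`L¹(min(1, |y|²) dy)`, uniformly over the class of kernels. -/
theorem exists_lintegral_trunc_mul_sub_le {n : ℕ} {s Lam : ℝ} (hs0 : 0 < s) (hs1 : s < 1)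
    {ω : ℝ → ℝ} (hω : IsModulus ω) {η : ℝ} (hη : 0 < η) :
    ∃ τ > 0, ∀ K : Rn n → Rn n → ℝ, (∀ x y, |K x y| ≤ Lam * fracKernel n s y) →
      HasModulusX s ω K → ∀ x x', ‖x - x'‖ < τ →
        ∫⁻ y, ENNReal.ofReal (trunc 2 y) * ‖K x y - K x' y‖ₑ ≤ ENNReal.ofReal η := by
  let Q : Rn n → ℝ≥0∞ := fun y =>
    ENNReal.ofReal (2 * Lam * (trunc 2 y * fracKernel n s y))
  have hQm : Measurable Q :=
    (((measurable_trunc 2).mul (measurable_fracKernel s)).const_mul _).ennreal_ofReal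
  have hQfin : ∫⁻ y, Q y ≠ ∞ := by
    have hi := (integrable_trunc_mul_fracKernel n hs0
      (show 2 * s < 2 by linarith)).const_mul (2 * Lam)
    exact hi.lintegral_lt_top.ne
  -- The sets `S N` exhaust `ℝⁿ \ {0}`, and each of them is covered by `2N` dyadic annuli.
  let S : ℕ → Set (Rn n) := fun N => ball 0 (2 ^ N) \ ball 0 (2 ^ N)⁻¹
  have hSm : ∀ N, MeasurableSet (S N) := fun N => measurableSet_ball.diff measurableSet_ball
  have hlim : Tendsto (fun N => ∫⁻ y, (S N)ᶜ.indicator Q y) atTop (𝓝 (∫⁻ _ : Rn n, 0)) := by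
    refine tendsto_lintegral_of_dominated_convergence Q
      (fun N => hQm.indicator (hSm N).compl)
      (fun N => Eventually.of_forall fun y => indicator_le_self _ _ _) hQfin
      (Eventually.of_forall fun y => ?_)
    by_cases hy : y = 0
    · have : Q y = 0 := by simp [Q, hy, trunc_zero]
      have h2 : ∀ N, (S N)ᶜ.indicator Q y = 0 := fun N => by
        simp [this]
      simp [h2]
    · have hy' : 0 < ‖y‖ := norm_pos_iff.2 hy
      have t1 : Tendsto (fun N : ℕ => (2 : ℝ) ^ N) atTop atTop :=
        tendsto_pow_atTop_atTop_of_one_lt one_lt_two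
      have e1 := t1.eventually_gt_atTop ‖y‖
      have e2 := (tendsto_inv_atTop_zero.comp t1).eventually (gt_mem_nhds hy')
      refine tendsto_const_nhds.congr' ?_
      filter_upwards [e1, e2] with N h1 h2
      rw [indicator_of_notMem]
      simp only [S, mem_compl_iff, Set.mem_sdiff, mem_ball_zero_iff, not_not, not_lt]
      exact ⟨h1, h2.le⟩
  rw [lintegral_zero] at hlim
  obtain ⟨N, hN⟩ := (hlim.eventually
    (gt_mem_nhds (show (0 : ℝ≥0∞) < ENNReal.ofReal (η / 2) by simpa using hη))).exists
  set r : ℝ := (2 ^ N)⁻¹ with hr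
  have hr0 : 0 < r := by positivity
  have hrN : (2 : ℝ) ^ (N + N) * r = 2 ^ N := by
    rw [pow_add, hr]
    field_simp
  set D : ℝ := ∑ k ∈ Finset.range (N + N), 1 / (2 ^ k * r) ^ (2 * s) with hD
  have hD0 : 0 ≤ D := Finset.sum_nonneg fun k _ => by positivity
  have hωD : Tendsto (fun t => ω t * D) (𝓝[>] 0) (𝓝 0) := by
    simpa using hω.tendsto_zero.mul_const D
  have hev := hωD.eventually (gt_mem_nhds (half_pos hη))
  obtain ⟨τ, hτ0, hτ⟩ := (mem_nhdsGT_iff_exists_Ioo_subset).1 hev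
  refine ⟨τ, hτ0, fun K hK hmod x x' hxx => ?_⟩
  have hω2 : ω ‖x - x'‖ * D ≤ η / 2 := by
    rcases (norm_nonneg (x - x')).eq_or_lt with h | h
    · rw [← h, hω.zero, zero_mul]
      positivity
    · exact le_of_lt (hτ ⟨h, hxx⟩)
  have hω0 : 0 ≤ ω ‖x - x'‖ := hω.nonneg _ (norm_nonneg _)
  rw [← lintegral_add_compl _ (hSm N)]
  have part1 : ∫⁻ y in S N, ENNReal.ofReal (trunc 2 y) * ‖K x y - K x' y‖ₑ ≤
      ENNReal.ofReal (η / 2) := by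
    calc _ ≤ ∫⁻ y in S N, ‖K x y - K x' y‖ₑ := by
          refine lintegral_mono fun y => ?_
          refine mul_le_of_le_one_left zero_le ?_
          simpa using trunc_le_one 2 y
      _ = ∫⁻ y in ball 0 (2 ^ (N + N) * r) \ ball 0 r, ‖K x y - K x' y‖ₑ := by rw [hrN]
      _ ≤ ∑ k ∈ Finset.range (N + N), ∫⁻ y in annulus n (2 ^ k * r), ‖K x y - K x' y‖ₑ :=
          lintegral_dyadic_le n _ _ _
      _ ≤ ∑ k ∈ Finset.range (N + N),
          ENNReal.ofReal (ω ‖x - x'‖ / (2 ^ k * r) ^ (2 * s)) :=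
          Finset.sum_le_sum fun k _ => hmod x x' _ (by positivity)
      _ = ENNReal.ofReal (ω ‖x - x'‖ * D) := by
          rw [← ENNReal.ofReal_sum_of_nonneg fun k _ => by positivity, hD, Finset.mul_sum]
          congr 1
          exact Finset.sum_congr rfl fun k _ => by ring
      _ ≤ _ := ENNReal.ofReal_le_ofReal hω2
  have part2 : ∫⁻ y in (S N)ᶜ, ENNReal.ofReal (trunc 2 y) * ‖K x y - K x' y‖ₑ ≤
      ENNReal.ofReal (η / 2) := by
    calc _ ≤ ∫⁻ y in (S N)ᶜ, Q y := by
          refine lintegral_mono fun y => ?_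
          rw [← ofReal_norm, ← ENNReal.ofReal_mul (trunc_nonneg _ _)]
          refine ENNReal.ofReal_le_ofReal ?_
          have h1 : ‖K x y - K x' y‖ ≤ 2 * (Lam * fracKernel n s y) := by
            refine (norm_sub_le _ _).trans ?_
            have := hK x y
            have := hK x' y
            simp only [Real.norm_eq_abs]
            linarith
          have := mul_le_mul_of_nonneg_left h1 (trunc_nonneg 2 y)
          linarith
      _ = ∫⁻ y, (S N)ᶜ.indicator Q y := (lintegral_indicator (hSm N).compl _).symm
      _ ≤ _ := hN.le
  calc _ ≤ ENNReal.ofReal (η / 2) + ENNReal.ofReal (η / 2) := add_le_add part1 part2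
    _ = ENNReal.ofReal η := by
      rw [← ENNReal.ofReal_add (by positivity) (by positivity), add_halves]

/-! ### Regularized kernels -/

/-- The kernel `K` with its values at `y = 0` replaced by `0`. With the convention
`fracKernel n s 0 = 0` the upper ellipticity bound then holds for every `y`, and no operator
changes, since second differences vanish at `y = 0`. -/
noncomputable def puncture {n : ℕ} (K : Rn n → Rn n → ℝ) (x y : Rn n) : ℝ :=
  open scoped Classical in if y = 0 then 0 else K x y

theorem linOp_puncture {n : ℕ} (K : Rn n → Rn n → ℝ) : linOp (puncture K) = linOp K := by
  funext u x
  unfold linOp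
  congr 2
  funext y
  by_cases hy : y = 0
  · subst hy
    have : 2 * u x - u x - u x = 0 := by ring
    simp [this]
  · simp [puncture, hy]

theorem fracKernel_zero {n : ℕ} {s : ℝ} (hs : 0 < s) : fracKernel n s 0 = 0 := by
  have : (n : ℝ) + 2 * s ≠ 0 := by positivity
  simp [fracKernel, Real.zero_rpow this]

theorem IsEllipticKernel.abs_le {n : ℕ} {s lam Lam : ℝ} {K : Rn n → Rn n → ℝ} (hs : 0 < s)
    (hlam : 0 < lam) (hK : IsEllipticKernel s lam Lam K) (h0 : ∀ x, K x 0 = 0) (x y : Rn n) :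
    |K x y| ≤ Lam * fracKernel n s y := by
  by_cases hy : y = 0
  · simp [hy, h0, fracKernel_zero hs]
  · have h1 := hK.lower x y hy
    have h2 := hK.upper x y hy
    have h3 : 0 ≤ lam / ‖y‖ ^ ((n : ℝ) + 2 * s) := by positivity
    rw [abs_of_nonneg (h3.trans h1), fracKernel, mul_one_div]
    exact h2

theorem MemLOmega.puncture {n : ℕ} {s lam Lam : ℝ} {ω : ℝ → ℝ} {K : Rn n → Rn n → ℝ}
    (hK : MemLOmega s lam Lam ω K) : MemLOmega s lam Lam ω (puncture K) := by
  have hne : ∀ x y, y ≠ 0 → NonlocalApprox.puncture K x y = K x y :=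
    fun x y hy => by simp [NonlocalApprox.puncture, hy]
  refine ⟨⟨?_, ?_, ?_, ?_⟩, ?_⟩
  · exact Measurable.ite (measurableSet_eq_fun measurable_snd measurable_const) measurable_const
      hK.1.measurable
  · intro x y
    by_cases hy : y = 0
    · simp [hy]
    · rw [hne x y hy, hne x (-y) (neg_ne_zero.2 hy)]
      exact hK.1.symm x y
  · intro x y hy
    rw [hne x y hy]
    exact hK.1.lower x y hy
  · intro x y hy
    rw [hne x y hy]
    exact hK.1.upper x y hy
  · intro x x' r hr
    refine le_trans (le_of_eq ?_) (hK.2 x x' r hr)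
    refine setLIntegral_congr_fun (measurableSet_ball.diff measurableSet_ball) fun y hy => ?_
    have hy0 : y ≠ 0 := by
      rintro rfl
      exact hy.2 (by simpa using hr)
    simp only [hne _ y hy0]

/-- The average of the kernel `K` in its first variable, with density `ψ`. -/
noncomputable def smearKernel {n : ℕ} (ψ : Rn n → ℝ) (K : Rn n → Rn n → ℝ) (x y : Rn n) : ℝ :=
  smear ψ (fun z => K z y) x

/-- Weighted `L¹` bounds that hold for each `H z` pass to averages over `z`, by Tonelli's theorem. -/
theorem lintegral_mul_enorm_average_le {n : ℕ} {ψ : Rn n → ℝ} {ρ : ℝ} (hψ : IsBump ψ ρ)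
    {H : Rn n → Rn n → ℝ} (hH : Measurable (Function.uncurry H)) {q : Rn n → ℝ≥0∞}
    (hq : Measurable q) (μ : Measure (Rn n)) [SFinite μ] {B : ℝ≥0∞}
    (hB : ∀ z, ‖z‖ < ρ → ∫⁻ y, q y * ‖H z y‖ₑ ∂μ ≤ B) :
    ∫⁻ y, q y * ‖∫ z, ψ z * H z y‖ₑ ∂μ ≤ B := by
  have hψm : Measurable ψ := hψ.smooth.continuous.measurable
  have hone : ∫⁻ z, ‖ψ z‖ₑ = 1 := by
    have h1 := ofReal_integral_eq_lintegral_ofReal hψ.integrable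
      (Eventually.of_forall hψ.nonneg)
    rw [hψ.integral_eq_one, ENNReal.ofReal_one] at h1
    rw [h1]
    exact lintegral_congr fun z => Real.enorm_of_nonneg (hψ.nonneg z)
  calc ∫⁻ y, q y * ‖∫ z, ψ z * H z y‖ₑ ∂μ
      ≤ ∫⁻ y, ∫⁻ z, ‖ψ z‖ₑ * (q y * ‖H z y‖ₑ) ∂volume ∂μ := by
        refine lintegral_mono fun y => ?_
        have hHy : Measurable fun z => H z y := hH.of_uncurry_right
        calc q y * ‖∫ z, ψ z * H z y‖ₑ ≤ q y * ∫⁻ z, ‖ψ z * H z y‖ₑ := by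
              gcongr
              exact enorm_integral_le_lintegral_enorm _
          _ = ∫⁻ z, ‖ψ z‖ₑ * (q y * ‖H z y‖ₑ) := by
              have hm : Measurable fun z => ‖ψ z * H z y‖ₑ := (hψm.mul hHy).enorm
              rw [← lintegral_const_mul _ hm]
              refine lintegral_congr fun z => ?_
              rw [enorm_mul]
              ring
    _ = ∫⁻ z, ∫⁻ y, ‖ψ z‖ₑ * (q y * ‖H z y‖ₑ) ∂μ ∂volume := by
        refine lintegral_lintegral_swap (Measurable.aemeasurable ?_)
        exact (hψm.comp measurable_snd).enorm.mul
          ((hq.comp measurable_fst).mul (hH.comp measurable_swap).enorm)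
    _ ≤ ∫⁻ z, ‖ψ z‖ₑ * B := by
        refine lintegral_mono fun z => ?_
        have hm : Measurable fun y => q y * ‖H z y‖ₑ := hq.mul hH.of_uncurry_left.enorm
        rw [lintegral_const_mul _ hm]
        by_cases hz : ψ z = 0
        · simp [hz]
        · gcongr
          exact hB z (hψ.norm_lt z hz)
    _ = B := by rw [lintegral_mul_const _ hψm.enorm, hone, one_mul]

section SmearKernel

variable {n : ℕ} {s lam Lam : ℝ} {ω : ℝ → ℝ} {ψ : Rn n → ℝ} {ρ : ℝ} {K : Rn n → Rn n → ℝ}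

theorem smearKernel_sub_smearKernel (hψ : IsBump ψ ρ) (hm : Measurable (Function.uncurry K))
    (hb : ∀ x y, |K x y| ≤ Lam * fracKernel n s y) (x x' y : Rn n) :
    smearKernel ψ K x y - smearKernel ψ K x' y = ∫ z, ψ z * (K (x - z) y - K (x' - z) y) := by
  have hmy : Measurable fun z => K z y := hm.of_uncurry_right
  simp_rw [mul_sub]
  rw [integral_sub (hψ.integrable_mul hmy (fun z => hb z y) x)
    (hψ.integrable_mul hmy (fun z => hb z y) x')]
  rfl

theorem smearKernel_sub_self (hψ : IsBump ψ ρ) (hm : Measurable (Function.uncurry K))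
    (hb : ∀ x y, |K x y| ≤ Lam * fracKernel n s y) (x y : Rn n) :
    smearKernel ψ K x y - K x y = ∫ z, ψ z * (K (x - z) y - K x y) := by
  have hmy : Measurable fun z => K z y := hm.of_uncurry_right
  simp_rw [mul_sub]
  rw [integral_sub (hψ.integrable_mul hmy (fun z => hb z y) x) (hψ.integrable.mul_const _),
    integral_mul_const, hψ.integral_eq_one, one_mul]
  rfl

theorem measurable_smearKernel (hψ : IsBump ψ ρ) (hm : Measurable (Function.uncurry K)) :
    Measurable (Function.uncurry (smearKernel ψ K)) := by
  have hψm : Measurable ψ := hψ.smooth.continuous.measurable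
  have : StronglyMeasurable (Function.uncurry
      fun (p : Rn n × Rn n) (z : Rn n) => ψ z * K (p.1 - z) p.2) := by
    refine Measurable.stronglyMeasurable ?_
    exact (hψm.comp measurable_snd).mul (hm.comp
      (((measurable_fst.comp measurable_fst).sub measurable_snd).prodMk
        (measurable_snd.comp measurable_fst)))
  exact this.integral_prod_right.measurable

theorem abs_smearKernel_le (hψ : IsBump ψ ρ) (hm : Measurable (Function.uncurry K))
    (hb : ∀ x y, |K x y| ≤ Lam * fracKernel n s y) (x y : Rn n) :
    |smearKernel ψ K x y| ≤ Lam * fracKernel n s y := by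
  have hmy : Measurable fun z => K z y := hm.of_uncurry_right
  simpa [smearKernel] using abs_smear_sub_le (c := 0) hψ hmy (fun z => hb z y) x
    (fun z _ => by simpa using hb (x - z) y)

/-- The class `𝔏^ω_s(λ, Λ)` is invariant under translations in `x` and convex, hence it is preserved
by averaging in `x`. -/
theorem memLOmega_smearKernel (hψ : IsBump ψ ρ) (hK : MemLOmega s lam Lam ω K)
    (hb : ∀ x y, |K x y| ≤ Lam * fracKernel n s y) : MemLOmega s lam Lam ω (smearKernel ψ K) := by
  have hm := hK.1.measurable
  have hmy : ∀ y, Measurable fun z => K z y := fun y => hm.of_uncurry_right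
  refine ⟨⟨measurable_smearKernel hψ hm, ?_, ?_, ?_⟩, ?_⟩
  · intro x y
    unfold smearKernel
    congr 1
    funext z
    exact hK.1.symm z y
  · exact fun x y hy => le_smear hψ (hmy y) (fun z => hb z y) x fun z _ => hK.1.lower _ y hy
  · exact fun x y hy => smear_le hψ (hmy y) (fun z => hb z y) x fun z _ => hK.1.upper _ y hy
  · intro x x' r hr
    have hH : Measurable (Function.uncurry fun z y => K (x - z) y - K (x' - z) y) :=
      (hm.comp ((measurable_const.sub measurable_fst).prodMk measurable_snd)).sub
        (hm.comp ((measurable_const.sub measurable_fst).prodMk measurable_snd))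
    have := lintegral_mul_enorm_average_le hψ hH (q := fun _ => 1) measurable_const
      (volume.restrict (annulus n r)) (B := ENNReal.ofReal (ω ‖x - x'‖ / r ^ (2 * s)))
      (fun z _ => by simpa using hK.2 (x - z) (x' - z) r hr)
    simpa only [one_mul, smearKernel_sub_smearKernel hψ hm hb] using this

theorem lintegral_trunc_mul_smearKernel_sub_le (hψ : IsBump ψ ρ)
    (hm : Measurable (Function.uncurry K)) (hb : ∀ x y, |K x y| ≤ Lam * fracKernel n s y)
    {B : ℝ≥0∞} (x : Rn n)
    (hB : ∀ z, ‖z‖ < ρ → ∫⁻ y, ENNReal.ofReal (trunc 2 y) * ‖K (x - z) y - K x y‖ₑ ≤ B) :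
    ∫⁻ y, ENNReal.ofReal (trunc 2 y) * ‖smearKernel ψ K x y - K x y‖ₑ ≤ B := by
  have hH : Measurable (Function.uncurry fun z y => K (x - z) y - K x y) :=
    (hm.comp ((measurable_const.sub measurable_fst).prodMk measurable_snd)).sub
      (hm.comp (measurable_const.prodMk measurable_snd))
  have := lintegral_mul_enorm_average_le hψ hH (measurable_trunc 2).ennreal_ofReal volume hB
  simpa only [smearKernel_sub_self hψ hm hb] using this

theorem contDiff_smearKernel (hψ : IsBump ψ ρ) (hm : Measurable (Function.uncurry K))
    (hb : ∀ x y, |K x y| ≤ Lam * fracKernel n s y) (y : Rn n) :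
    ContDiff ℝ (⊤ : ℕ∞) fun x => smearKernel ψ K x y :=
  contDiff_smear hψ (locallyIntegrable_of_bounded hm.of_uncurry_right fun z => hb z y)

theorem norm_iteratedFDeriv_smearKernel_le (hψ : IsBump ψ ρ) (hm : Measurable (Function.uncurry K))
    (hb : ∀ x y, |K x y| ≤ Lam * fracKernel n s y) (k : ℕ) (x y : Rn n) :
    ‖iteratedFDeriv ℝ k (fun x => smearKernel ψ K x y) x‖ ≤
      Lam * (∫ z, ‖iteratedFDeriv ℝ k ψ z‖) * fracKernel n s y := by
  refine (norm_iteratedFDeriv_smear_le hψ hm.of_uncurry_right (fun z => hb z y) k x).trans_eq ?_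
  ring

end SmearKernel

/-! ### Kernels with derivatives of every order in `x` -/

/-- Kernels that are smooth in `x`, with `k`-th derivative bounded by `C k * |y|^{-n-2s}`. -/
structure SmoothKernelBound {n : ℕ} (s : ℝ) (C : ℕ → ℝ) (K : Rn n → Rn n → ℝ) : Prop where
  contDiff : ∀ y, ContDiff ℝ (⊤ : ℕ∞) fun x => K x y
  norm_le : ∀ k x y, ‖iteratedFDeriv ℝ k (fun x => K x y) x‖ ≤ C k * fracKernel n s y

theorem holderOrder_exponent {μ : ℝ} (hμ : 0 < μ) :
    0 < μ - holderOrder μ ∧ μ - holderOrder μ ≤ 1 := by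
  unfold holderOrder
  constructor
  · rcases le_or_gt (μ - 1) 0 with h | h
    · rw [Nat.ceil_eq_zero.2 h]
      simpa using hμ
    · linarith [Nat.ceil_lt_add_one h.le]
  · linarith [Nat.le_ceil (μ - 1)]

/-- A bounded Lipschitz map is Hölder of every order `θ ∈ [0, 1]`. -/
theorem norm_sub_le_rpow_of_bounded_of_lipschitz {E F : Type*} [NormedAddCommGroup E]
    [NormedAddCommGroup F] {g : E → F} {A B θ : ℝ} (hA : ∀ x, ‖g x‖ ≤ A)
    (hB : ∀ x x', ‖g x - g x'‖ ≤ B * ‖x - x'‖) (hA0 : 0 ≤ A) (hB0 : 0 ≤ B) (hθ0 : 0 ≤ θ)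
    (hθ1 : θ ≤ 1) (x x' : E) : ‖g x - g x'‖ ≤ (2 * A + B) * ‖x - x'‖ ^ θ := by
  rcases le_total ‖x - x'‖ 1 with h | h
  · have h1 : ‖x - x'‖ ≤ ‖x - x'‖ ^ θ := by
      rcases (norm_nonneg (x - x')).eq_or_lt with h0 | h0
      · rw [← h0]
        positivity
      · simpa using Real.rpow_le_rpow_of_exponent_ge h0 h hθ1
    calc _ ≤ B * ‖x - x'‖ := hB x x'
      _ ≤ B * ‖x - x'‖ ^ θ := by gcongr
      _ ≤ _ := by
        gcongr
        linarith
  · have h1 : 1 ≤ ‖x - x'‖ ^ θ := Real.one_le_rpow h hθ0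
    calc _ ≤ A + A := (norm_sub_le _ _).trans (add_le_add (hA x) (hA x'))
      _ ≤ (2 * A + B) * 1 := by linarith
      _ ≤ _ := by gcongr

/-- Pointwise bounds on the derivatives in `x` give `[K]^x_μ < ∞` for every `μ > 0`. The constant
depends only on these bounds, so it serves a whole family of kernels. -/
theorem SmoothKernelBound.exists_holderXBound (n : ℕ) {s μ : ℝ} {C : ℕ → ℝ} (hs : 0 < s)
    (hC : ∀ k, 0 ≤ C k) (hμ : 0 < μ) : ∃ D : ℝ, ∀ K : Rn n → Rn n → ℝ, SmoothKernelBound s C K →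
      HolderXBound s μ D K := by
  obtain ⟨hθ0, hθ1⟩ := holderOrder_exponent hμ
  set m := holderOrder μ
  have hA0 : 0 ≤ 2 * C m + C (m + 1) := by linarith [hC m, hC (m + 1)]
  refine ⟨(2 * C m + C (m + 1)) * (2 ^ n * volume.real (ball (0 : Rn n) 1)), fun K hK =>
    ⟨fun y _ => (hK.contDiff y).of_le (by exact_mod_cast le_top), fun x x' r hr => ?_⟩⟩
  have key : ∀ y, ‖iteratedFDeriv ℝ m (fun z => K z y) x -
      iteratedFDeriv ℝ m (fun z => K z y) x'‖ ≤
      (2 * C m + C (m + 1)) * ‖x - x'‖ ^ (μ - m) * fracKernel n s y := by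
    intro y
    have hf := fracKernel_nonneg (n := n) s y
    have hlip : ∀ a b, ‖iteratedFDeriv ℝ m (fun z => K z y) a -
        iteratedFDeriv ℝ m (fun z => K z y) b‖ ≤ C (m + 1) * fracKernel n s y * ‖a - b‖ := by
      intro a b
      refine convex_univ.norm_image_sub_le_of_norm_fderiv_le (𝕜 := ℝ) (fun z _ => ?_)
        (fun z _ => ?_) (mem_univ b) (mem_univ a)
      · exact ((hK.contDiff y).differentiable_iteratedFDeriv
          (by exact_mod_cast ENat.natCast_lt_top m)) z
      · rw [norm_fderiv_iteratedFDeriv]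
        exact hK.norm_le (m + 1) z y
    refine (norm_sub_le_rpow_of_bounded_of_lipschitz (fun z => hK.norm_le m z y) hlip
      (mul_nonneg (hC m) hf) (mul_nonneg (hC _) hf) hθ0.le hθ1 x x').trans_eq ?_
    ring
  have hD0 : 0 ≤ (2 * C m + C (m + 1)) * ‖x - x'‖ ^ (μ - m) := by positivity
  calc _ ≤ ∫⁻ y in annulus n r,
        ENNReal.ofReal ((2 * C m + C (m + 1)) * ‖x - x'‖ ^ (μ - m) * fracKernel n s y) := by
        refine lintegral_mono fun y => ?_
        rw [← ofReal_norm]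
        exact ENNReal.ofReal_le_ofReal (key y)
    _ ≤ _ := lintegral_fracKernel_annulus_le n hs hD0 hr
    _ = _ := by
        congr 1
        ring

/-! ### Convex combinations of kernels -/

section ConvexCombination

variable {n : ℕ} {s lam Lam : ℝ} {ω : ℝ → ℝ} {ι : Type*} [Fintype ι] {t : ι → ℝ}
  {K : ι → Rn n → Rn n → ℝ}

theorem memLOmega_sum (ht : ∀ i, 0 ≤ t i) (ht1 : ∑ i, t i = 1)
    (hω : ∀ a, 0 ≤ a → 0 ≤ ω a) (hK : ∀ i, MemLOmega s lam Lam ω (K i)) :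
    MemLOmega s lam Lam ω fun x y => ∑ i, t i * K i x y := by
  refine ⟨⟨?_, ?_, ?_, ?_⟩, ?_⟩
  · exact Finset.measurable_fun_sum _ fun i _ => (hK i).1.measurable.const_mul (t i)
  · intro x y
    exact Finset.sum_congr rfl fun i _ => by rw [(hK i).1.symm x y]
  · intro x y hy
    calc _ = ∑ i, t i * (lam / ‖y‖ ^ ((n : ℝ) + 2 * s)) := by rw [← Finset.sum_mul, ht1, one_mul]
      _ ≤ _ := Finset.sum_le_sum fun i _ =>
        mul_le_mul_of_nonneg_left ((hK i).1.lower x y hy) (ht i)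
  · intro x y hy
    calc _ ≤ ∑ i, t i * (Lam / ‖y‖ ^ ((n : ℝ) + 2 * s)) := Finset.sum_le_sum fun i _ =>
        mul_le_mul_of_nonneg_left ((hK i).1.upper x y hy) (ht i)
      _ = _ := by rw [← Finset.sum_mul, ht1, one_mul]
  · intro x x' r hr
    have hw := hω _ (norm_nonneg (x - x'))
    have hm : ∀ i z, Measurable (K i z) := fun i z => (hK i).1.measurable.of_uncurry_left
    calc ∫⁻ y in annulus n r, ‖∑ i, t i * K i x y - ∑ i, t i * K i x' y‖ₑ
        ≤ ∫⁻ y in annulus n r, ∑ i, ENNReal.ofReal (t i) * ‖K i x y - K i x' y‖ₑ := by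
          refine lintegral_mono fun y => ?_
          rw [← Finset.sum_sub_distrib]
          refine (enorm_sum_le _ _).trans_eq (Finset.sum_congr rfl fun i _ => ?_)
          rw [← mul_sub, enorm_mul, Real.enorm_of_nonneg (ht i)]
      _ = ∑ i, ENNReal.ofReal (t i) * ∫⁻ y in annulus n r, ‖K i x y - K i x' y‖ₑ := by
          have hmi : ∀ i, Measurable fun y => ‖K i x y - K i x' y‖ₑ :=
            fun i => ((hm i x).sub (hm i x')).enorm
          rw [lintegral_finsetSum _ fun i _ => (hmi i).const_mul _]
          exact Finset.sum_congr rfl fun i _ => lintegral_const_mul _ (hmi i)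
      _ ≤ ∑ i, ENNReal.ofReal (t i) * ENNReal.ofReal (ω ‖x - x'‖ / r ^ (2 * s)) :=
          Finset.sum_le_sum fun i _ => by
            gcongr
            exact (hK i).2 x x' r hr
      _ = _ := by
          rw [← Finset.sum_mul, ← ENNReal.ofReal_sum_of_nonneg fun i _ => ht i, ht1,
            ENNReal.ofReal_one, one_mul]

theorem smoothKernelBound_sum {C : ℕ → ℝ} (ht : ∀ i, 0 ≤ t i) (ht1 : ∑ i, t i = 1)
    (hK : ∀ i, SmoothKernelBound s C (K i)) :
    SmoothKernelBound s C fun x y => ∑ i, t i * K i x y := by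
  refine ⟨fun y => ContDiff.sum fun i _ => contDiff_const.mul ((hK i).contDiff y),
    fun k x y => ?_⟩
  have hki : ∀ i, ContDiff ℝ k fun x => K i x y :=
    fun i => ((hK i).contDiff y).of_le (by exact_mod_cast le_top)
  rw [iteratedFDeriv_fun_sum_apply fun i _ => (contDiff_const.mul (hki i)).contDiffAt]
  calc _ ≤ ∑ i, ‖iteratedFDeriv ℝ k (fun x => t i * K i x y) x‖ := norm_sum_le _ _
    _ ≤ ∑ i, t i * (C k * fracKernel n s y) := Finset.sum_le_sum fun i _ => by
      have : iteratedFDeriv ℝ k (fun x => t i * K i x y) x =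
          t i • iteratedFDeriv ℝ k (fun x => K i x y) x :=
        iteratedFDeriv_const_smul_apply (a := t i) (hki i).contDiffAt
      rw [this, norm_smul, Real.norm_of_nonneg (ht i)]
      exact mul_le_mul_of_nonneg_left ((hK i).norm_le k x y) (ht i)
    _ = _ := by rw [← Finset.sum_mul, ht1, one_mul]

end ConvexCombination

/-! ### Second differences -/

/-- The second difference `2 u(x) - u(x+y) - u(x-y)`. -/
def secondDiff {n : ℕ} (u : Rn n → ℝ) (x y : Rn n) : ℝ := 2 * u x - u (x + y) - u (x - y)

theorem linOp_eq {n : ℕ} (K : Rn n → Rn n → ℝ) (u : Rn n → ℝ) (x : Rn n) :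
    linOp K u x = (1 / 2) * ∫ y, secondDiff u x y * K x y := rfl

theorem measurable_secondDiff {n : ℕ} {u : Rn n → ℝ} (hu : Measurable u) (x : Rn n) :
    Measurable (secondDiff u x) :=
  (measurable_const.sub (hu.comp (measurable_const.add measurable_id))).sub
    (hu.comp (measurable_const.sub measurable_id))

/-- A modulus `A` for the gradient about `x` bounds the second difference by `2 A |y|`. -/
theorem norm_second_difference_le {E F : Type*} [NormedAddCommGroup E] [NormedSpace ℝ E]
    [NormedAddCommGroup F] [NormedSpace ℝ F] {G : E → F} {S : Set E} (hS : Convex ℝ S)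
    (hG : ∀ z ∈ S, DifferentiableAt ℝ G z) {x y : E} (hx : x ∈ S) (hxy : x + y ∈ S)
    (hxy' : x - y ∈ S) {A : ℝ}
    (hA : ∀ z ∈ S, ‖z - x‖ ≤ ‖y‖ → ‖fderiv ℝ G z - fderiv ℝ G x‖ ≤ A) :
    ‖G x + G x - G (x + y) - G (x - y)‖ ≤ 2 * A * ‖y‖ := by
  have hconv := hS.inter (convex_closedBall x ‖y‖)
  have key : ∀ z ∈ S ∩ closedBall x ‖y‖, ‖G z - G x - fderiv ℝ G x (z - x)‖ ≤ A * ‖z - x‖ :=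
    fun z hz => hconv.norm_image_sub_le_of_norm_fderiv_le' (fun z hz => hG z hz.1)
      (fun z hz => hA z hz.1 (by simpa [dist_eq_norm] using hz.2)) ⟨hx, by simp⟩ hz
  have h1 := key (x + y) ⟨hxy, by simp⟩
  have h2 := key (x - y) ⟨hxy', by simp⟩
  have e : G x + G x - G (x + y) - G (x - y) =
      -((G (x + y) - G x - fderiv ℝ G x (x + y - x)) +
        (G (x - y) - G x - fderiv ℝ G x (x - y - x))) := by
    have a1 : x + y - x = y := by abel
    have a2 : x - y - x = -y := by abel
    rw [a1, a2, map_neg]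
    abel
  rw [e, norm_neg]
  refine (norm_add_le _ _).trans ((add_le_add h1 h2).trans_eq ?_)
  have a1 : x + y - x = y := by abel
  have a2 : x - y - x = -y := by abel
  rw [a1, a2, norm_neg]
  ring

/-- The second difference in `y` commutes with the derivatives in `x`, hence the bound by
`min(1, |y|²)` holds for its derivatives of every order. -/
theorem exists_norm_iteratedFDeriv_secondDiff_le {n : ℕ} {u : Rn n → ℝ}
    (hu : ContDiff ℝ (⊤ : ℕ∞) u) (hc : HasCompactSupport u) :
    ∃ C : ℕ → ℝ, ∀ k x y, ‖iteratedFDeriv ℝ k (fun x => secondDiff u x y) x‖ ≤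
      C k * trunc 2 y := by
  have hB : ∀ k, ∃ B, ∀ x, ‖iteratedFDeriv ℝ k u x‖ ≤ B := fun k =>
    (hc.iteratedFDeriv k).exists_bound_of_continuous
      (hu.continuous_iteratedFDeriv (by exact_mod_cast le_top))
  choose B hB using hB
  have hB0 : ∀ k, 0 ≤ B k := fun k => (norm_nonneg _).trans (hB k 0)
  refine ⟨fun k => 4 * B k + 2 * B (k + 2), fun k x y => ?_⟩
  have hk : ∀ k : ℕ, ContDiff ℝ k u := fun k => hu.of_le (by exact_mod_cast le_top)
  have hdiff : ∀ k : ℕ, Differentiable ℝ (iteratedFDeriv ℝ k u) := fun k =>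
    hu.differentiable_iteratedFDeriv (by exact_mod_cast ENat.natCast_lt_top k)
  set G := iteratedFDeriv ℝ k u
  have e : iteratedFDeriv ℝ k (fun x => secondDiff u x y) x =
      G x + G x - G (x + y) - G (x - y) := by
    have e1 : (fun x => secondDiff u x y) =
        ((u + u) - fun x => u (x + y)) - fun x => u (x - y) := by
      funext x
      simp [secondDiff, two_mul]
    have c1 : ContDiff ℝ k fun x => u (x + y) := (hk k).comp (contDiff_id.add contDiff_const)
    have c2 : ContDiff ℝ k fun x => u (x - y) := (hk k).comp (contDiff_id.sub contDiff_const)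
    have c0 : ContDiff ℝ k (u + u) := (hk k).add (hk k)
    have c01 : ContDiff ℝ k ((u + u) - fun x => u (x + y)) := c0.sub c1
    rw [e1, iteratedFDeriv_sub c01 c2, iteratedFDeriv_sub c0 c1, iteratedFDeriv_add (hk k) (hk k)]
    simp only [Pi.sub_apply, Pi.add_apply, iteratedFDeriv_comp_add_right,
      iteratedFDeriv_comp_sub]
    rfl
  rw [e]
  have hlip : ∀ z, ‖fderiv ℝ G z - fderiv ℝ G x‖ ≤ B (k + 2) * ‖z - x‖ := by
    intro z
    simp only [G, fderiv_iteratedFDeriv, Function.comp_apply]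
    refine le_trans (b := ‖iteratedFDeriv ℝ (k + 1) u z - iteratedFDeriv ℝ (k + 1) u x‖)
      (le_of_eq ?_) ?_
    · have key := (continuousMultilinearCurryLeftEquiv ℝ (fun _ : Fin (k + 1) => Rn n) ℝ).dist_map
        (iteratedFDeriv ℝ (k + 1) u z) (iteratedFDeriv ℝ (k + 1) u x)
      rwa [dist_eq_norm, dist_eq_norm] at key
    refine convex_univ.norm_image_sub_le_of_norm_fderiv_le (𝕜 := ℝ) (fun z _ => hdiff _ z)
        (fun z _ => ?_) (mem_univ x) (mem_univ z)
    rw [norm_fderiv_iteratedFDeriv]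
    exact hB _ z
  have h1 : ‖G x + G x - G (x + y) - G (x - y)‖ ≤ 4 * B k := by
    have n1 := norm_sub_le (G x + G x - G (x + y)) (G (x - y))
    have n2 := norm_sub_le (G x + G x) (G (x + y))
    have n3 := norm_add_le (G x) (G x)
    linarith [hB k x, hB k (x + y), hB k (x - y)]
  have h2 : ‖G x + G x - G (x + y) - G (x - y)‖ ≤ 2 * B (k + 2) * ‖y‖ ^ (2 : ℝ) := by
    refine (norm_second_difference_le (A := B (k + 2) * ‖y‖) convex_univ (fun z _ => hdiff k z)
      (mem_univ x) (mem_univ _) (mem_univ _) fun z _ hz => (hlip z).trans ?_).trans_eq ?_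
    · have := hB0 (k + 2)
      gcongr
    · rw [Real.rpow_two]
      ring
  have := hB0 k
  have := hB0 (k + 2)
  unfold trunc
  rw [mul_min_of_nonneg _ _ (by positivity)]
  refine le_min (by linarith) (h2.trans ?_)
  gcongr
  linarith

/-! ### Integrals depending smoothly on a parameter -/

section Parametric

variable {n : ℕ} {Y : Type} [MeasurableSpace Y]

/-- Unlike `measurable_fderiv_with_param`, this requires no continuity in the parameter: directional
derivatives are pointwise limits of difference quotients. -/
theorem stronglyMeasurable_fderiv_of_param {F : Type} [NormedAddCommGroup F] [NormedSpace ℝ F]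
    {H : Rn n → Y → F} (hm : ∀ x, StronglyMeasurable (H x))
    (hd : ∀ y, Differentiable ℝ fun x => H x y) (x : Rn n) :
    StronglyMeasurable fun y => fderiv ℝ (fun x => H x y) x := by
  have hv : ∀ v : Rn n, StronglyMeasurable fun y => fderiv ℝ (fun x => H x y) x v := by
    intro v
    have hcast : Tendsto (fun k : ℕ => ‖(k : ℝ)‖) atTop atTop := by
      simpa using tendsto_natCast_atTop_atTop (R := ℝ)
    refine stronglyMeasurable_of_tendsto atTop
      (f := fun (k : ℕ) y => (k : ℝ) • (H (x + (k : ℝ)⁻¹ • v) y - H x y))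
      (fun k => ((hm _).sub (hm _)).const_smul _) (tendsto_pi_nhds.2 fun y => ?_)
    exact (hd y x).hasFDerivAt.lim v hcast
  let b := EuclideanSpace.basisFun (Fin n) ℝ
  have e : ∀ L : Rn n →L[ℝ] F, L = ∑ i, (innerSL ℝ (b i)).smulRight (L (b i)) := by
    intro L
    ext v
    conv_lhs => rw [← b.sum_repr' v]
    simp
  have e2 : (fun y => fderiv ℝ (fun x => H x y) x) = fun y =>
      ∑ i, (innerSL ℝ (b i)).smulRight (fderiv ℝ (fun x => H x y) x (b i)) :=
    funext fun y => e _
  rw [e2]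
  refine Finset.stronglyMeasurable_fun_sum _ fun i _ => ?_
  exact (ContinuousLinearMap.smulRightL ℝ (Rn n) F
    (innerSL ℝ (b i))).continuous.comp_stronglyMeasurable (hv (b i))

theorem hasFDerivAt_integral_of_dominated {F : Type} [NormedAddCommGroup F] [NormedSpace ℝ F]
    {μ : Measure Y} {H : Rn n → Y → F} {b : ℕ → Y → ℝ}
    (hm : ∀ x, StronglyMeasurable (H x)) (hd : ∀ y, ContDiff ℝ (⊤ : ℕ∞) fun x => H x y)
    (hb : ∀ k x y, ‖iteratedFDeriv ℝ k (fun x => H x y) x‖ ≤ b k y)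
    (hbi : ∀ k, Integrable (b k) μ) (x₀ : Rn n) :
    HasFDerivAt (fun x => ∫ y, H x y ∂μ) (∫ y, fderiv ℝ (fun x => H x y) x₀ ∂μ) x₀ := by
  have hdiff : ∀ y, Differentiable ℝ fun x => H x y := fun y => (hd y).differentiable (by simp)
  have hint : Integrable (H x₀) μ := (hbi 0).mono' (hm x₀).aestronglyMeasurable
    (Eventually.of_forall fun y => by simpa using hb 0 x₀ y)
  refine hasFDerivAt_integral_of_dominated_of_fderiv_le (bound := b 1) (s := univ)
    univ_mem (Eventually.of_forall fun x => (hm x).aestronglyMeasurable) hint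
    (stronglyMeasurable_fderiv_of_param hm hdiff x₀).aestronglyMeasurable
    (Eventually.of_forall fun y x _ => ?_) (hbi 1)
    (Eventually.of_forall fun y x _ => (hdiff y x).hasFDerivAt)
  have := hb 1 x y
  rwa [norm_iteratedFDeriv_one] at this

theorem contDiff_nat_integral_of_dominated {F : Type} [NormedAddCommGroup F] [NormedSpace ℝ F]
    (N : ℕ) {μ : Measure Y} {H : Rn n → Y → F} {b : ℕ → Y → ℝ}
    (hm : ∀ x, StronglyMeasurable (H x)) (hd : ∀ y, ContDiff ℝ (⊤ : ℕ∞) fun x => H x y)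
    (hb : ∀ k x y, ‖iteratedFDeriv ℝ k (fun x => H x y) x‖ ≤ b k y)
    (hbi : ∀ k, Integrable (b k) μ) : ContDiff ℝ N fun x => ∫ y, H x y ∂μ := by
  have hderiv := hasFDerivAt_integral_of_dominated hm hd hb hbi
  induction N generalizing F b with
  | zero =>
    simp only [CharP.cast_eq_zero, contDiff_zero]
    exact continuous_iff_continuousAt.2 fun x => (hderiv x).continuousAt
  | succ N ih =>
    have hcast : ((N + 1 : ℕ) : WithTop ℕ∞) = (N : WithTop ℕ∞) + 1 := by norm_cast
    rw [hcast, contDiff_succ_iff_fderiv]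
    refine ⟨fun x => (hderiv x).differentiableAt, by simp, ?_⟩
    have e : fderiv ℝ (fun x => ∫ y, H x y ∂μ) = fun x => ∫ y, fderiv ℝ (fun x => H x y) x ∂μ :=
      funext fun x => (hderiv x).fderiv
    rw [e]
    have hm' : ∀ x, StronglyMeasurable fun y => fderiv ℝ (fun x => H x y) x :=
      stronglyMeasurable_fderiv_of_param hm fun y => (hd y).differentiable (by simp)
    have hd' : ∀ y, ContDiff ℝ (⊤ : ℕ∞) (fderiv ℝ fun x => H x y) :=
      fun y => (hd y).fderiv_right (by norm_cast)
    have hb' : ∀ k x y, ‖iteratedFDeriv ℝ k (fderiv ℝ fun x => H x y) x‖ ≤ b (k + 1) y :=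
      fun k x y => by
        rw [norm_iteratedFDeriv_fderiv]
        exact hb (k + 1) x y
    have hbi' : ∀ k, Integrable (fun y => b (k + 1) y) μ := fun k => hbi (k + 1)
    exact ih (H := fun x y => fderiv ℝ (fun x => H x y) x) hm' hd' hb' hbi'
      (hasFDerivAt_integral_of_dominated (H := fun x y => fderiv ℝ (fun x => H x y) x)
        hm' hd' hb' hbi')

theorem contDiff_integral_of_dominated {F : Type} [NormedAddCommGroup F] [NormedSpace ℝ F]
    {μ : Measure Y} {H : Rn n → Y → F} {b : ℕ → Y → ℝ}
    (hm : ∀ x, StronglyMeasurable (H x)) (hd : ∀ y, ContDiff ℝ (⊤ : ℕ∞) fun x => H x y)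
    (hb : ∀ k x y, ‖iteratedFDeriv ℝ k (fun x => H x y) x‖ ≤ b k y)
    (hbi : ∀ k, Integrable (b k) μ) : ContDiff ℝ (⊤ : ℕ∞) fun x => ∫ y, H x y ∂μ :=
  contDiff_infty.2 fun N => contDiff_nat_integral_of_dominated N hm hd hb hbi

end Parametric

/-- Derivatives in `x` of the second difference keep the factor `min(1, |y|²)`, and those of the
kernel the factor `|y|^{-n-2s}`, so that the integral may be differentiated any number of times. -/
theorem contDiff_linOp {n : ℕ} {s : ℝ} {C : ℕ → ℝ} (hs0 : 0 < s) (hs1 : s < 1)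
    {K : Rn n → Rn n → ℝ} (hm : Measurable (Function.uncurry K)) (hK : SmoothKernelBound s C K)
    {u : Rn n → ℝ} (hu : ContDiff ℝ (⊤ : ℕ∞) u) (hc : HasCompactSupport u) :
    ContDiff ℝ (⊤ : ℕ∞) (linOp K u) := by
  obtain ⟨D, hD⟩ := exists_norm_iteratedFDeriv_secondDiff_le hu hc
  have hsd : ∀ y, ContDiff ℝ (⊤ : ℕ∞) fun x => secondDiff u x y := fun y =>
    ((contDiff_const.mul hu).sub (hu.comp (contDiff_id.add contDiff_const))).sub
      (hu.comp (contDiff_id.sub contDiff_const))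
  refine contDiff_const.mul (contDiff_integral_of_dominated
    (H := fun x y => secondDiff u x y * K x y)
    (b := fun k y => (∑ i ∈ Finset.range (k + 1), (k.choose i : ℝ) * D i * C (k - i)) *
      (trunc 2 y * fracKernel n s y))
    (fun x => ((measurable_secondDiff hu.continuous.measurable x).mul
      hm.of_uncurry_left).stronglyMeasurable)
    (fun y => (hsd y).mul (hK.contDiff y)) (fun k x y => ?_) (fun k =>
      (integrable_trunc_mul_fracKernel n hs0 (by linarith)).const_mul _))
  refine (norm_iteratedFDeriv_mul_le (N := (⊤ : ℕ∞)) (hsd y) (hK.contDiff y) x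
    (by exact_mod_cast le_top)).trans ?_
  rw [Finset.sum_mul]
  refine Finset.sum_le_sum fun i _ => ?_
  have h1 := hD i x y
  have h2 := hK.norm_le (k - i) x y
  calc _ ≤ (k.choose i : ℝ) * (D i * trunc 2 y) * (C (k - i) * fracKernel n s y) := by
        rw [mul_assoc, mul_assoc]
        exact mul_le_mul_of_nonneg_left (mul_le_mul h1 h2 (norm_nonneg _)
          ((norm_nonneg _).trans h1)) (Nat.cast_nonneg _)
    _ = _ := by ring

/-! ### Inf-sup values in the extended reals -/

section InfSup

variable {A : Type v} {B : Type w}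

theorem iInf_iSup_coe_le_iff {V : A → B → ℝ} {t : ℝ} :
    (⨅ b, ⨆ a, (V a b : EReal)) ≤ t ↔ ∀ κ > 0, ∃ b, ∀ a, V a b ≤ t + κ := by
  constructor
  · intro h κ hκ
    have h1 : (⨅ b, ⨆ a, (V a b : EReal)) < ((t + κ : ℝ) : EReal) :=
      h.trans_lt (by exact_mod_cast lt_add_of_pos_right t hκ)
    obtain ⟨b, hb⟩ := iInf_lt_iff.1 h1
    exact ⟨b, fun a => by exact_mod_cast (le_iSup (fun a => (V a b : EReal)) a).trans hb.le⟩
  · intro h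
    refine le_of_forall_gt fun c hc => ?_
    obtain ⟨d, hd1, hd2⟩ := EReal.lt_iff_exists_real_btwn.1 hc
    have hd1 : t < d := by exact_mod_cast hd1
    obtain ⟨b, hb⟩ := h (d - t) (sub_pos.2 hd1)
    refine lt_of_le_of_lt ((iInf_le _ b).trans (iSup_le fun a => ?_)) hd2
    have := hb a
    exact_mod_cast (by linarith : V a b ≤ d)

theorem coe_le_iInf_iSup_iff {V : A → B → ℝ} {t : ℝ} :
    (t : EReal) ≤ (⨅ b, ⨆ a, (V a b : EReal)) ↔ ∀ b, ∀ κ > 0, ∃ a, t - κ ≤ V a b := by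
  constructor
  · intro h b κ hκ
    have h1 : ((t - κ : ℝ) : EReal) < ⨆ a, (V a b : EReal) :=
      lt_of_lt_of_le (by exact_mod_cast sub_lt_self t hκ) (h.trans (iInf_le _ b))
    obtain ⟨a, ha⟩ := lt_iSup_iff.1 h1
    exact ⟨a, by exact_mod_cast ha.le⟩
  · intro h
    refine le_iInf fun b => le_of_forall_lt fun c hc => ?_
    obtain ⟨d, hd1, hd2⟩ := EReal.lt_iff_exists_real_btwn.1 hc
    have hd2 : d < t := by exact_mod_cast hd2
    obtain ⟨a, ha⟩ := h b (t - d) (sub_pos.2 hd2)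
    refine hd1.trans_le (le_trans ?_ (le_iSup _ a))
    exact_mod_cast (by linarith : d ≤ V a b)

theorem iInf_iSup_coe_le_of_le {V W : A → B → ℝ} {t η : ℝ}
    (h : ∀ a b, V a b ≤ W a b + η) (hW : (⨅ b, ⨆ a, (W a b : EReal)) ≤ t) :
    (⨅ b, ⨆ a, (V a b : EReal)) ≤ ((t + η : ℝ) : EReal) := by
  rw [iInf_iSup_coe_le_iff] at hW ⊢
  intro κ hκ
  obtain ⟨b, hb⟩ := hW κ hκ
  exact ⟨b, fun a => by linarith [h a b, hb a]⟩

theorem coe_le_iInf_iSup_of_le {V W : A → B → ℝ} {t η : ℝ}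
    (h : ∀ a b, W a b - η ≤ V a b) (hW : (t : EReal) ≤ ⨅ b, ⨆ a, (W a b : EReal)) :
    ((t - η : ℝ) : EReal) ≤ (⨅ b, ⨆ a, (V a b : EReal)) := by
  rw [coe_le_iInf_iSup_iff] at hW ⊢
  intro b κ hκ
  obtain ⟨a, ha⟩ := hW b κ hκ
  exact ⟨a, by linarith [h a b]⟩

/-- Inf-sup values depend on the family in a nonexpansive way. -/
theorem abs_sub_le_of_iInf_iSup_eq {V W : A → B → ℝ} {t t' η : ℝ}
    (h : ∀ a b, |V a b - W a b| ≤ η) (hV : (⨅ b, ⨆ a, (V a b : EReal)) = t)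
    (hW : (⨅ b, ⨆ a, (W a b : EReal)) = t') : |t - t'| ≤ η := by
  have h1 := iInf_iSup_coe_le_of_le (η := η) (V := V)
    (fun a b => by linarith [(abs_le.1 (h a b)).2]) hW.le
  have h2 := coe_le_iInf_iSup_of_le (η := η) (V := V)
    (fun a b => by linarith [(abs_le.1 (h a b)).1]) hW.ge
  rw [hV] at h1 h2
  have h1 : t ≤ t' + η := by exact_mod_cast h1
  have h2 : t' - η ≤ t := by exact_mod_cast h2
  rw [abs_le]
  constructor <;> linarith

end InfSup

/-! ### Smooth approximation of maxima and minima -/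

section Soft

variable {ι : Type*} [Fintype ι]

/-- The smooth maximum `β⁻¹ log ∑ exp(β vᵢ)`, with inverse temperature `β`. -/
noncomputable def softMax (β : ℝ) (v : ι → ℝ) : ℝ := β⁻¹ * Real.log (∑ i, Real.exp (β * v i))

/-- The gradient of `softMax`, a vector of convex weights. -/
noncomputable def softWeight (β : ℝ) (v : ι → ℝ) (i : ι) : ℝ :=
  Real.exp (β * v i) / ∑ j, Real.exp (β * v j)

/-- The smooth version of `min_j max_k V_{jk}`. -/
noncomputable def softMinMax (β : ℝ) (V : ι → ι → ℝ) : ℝ := -softMax β fun j => -softMax β (V j)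

/-- The affine functions of `V` whose inf-sup over `r` and `q` is `softMinMax β V`: tangent planes
at `q j` to the inner smooth maxima are inserted into the tangent plane at `r` to the outer smooth
minimum. -/
noncomputable def softPlane (β : ℝ) (r : ι → ℝ) (q V : ι → ι → ℝ) : ℝ :=
  -softMax β (-r) + ∑ j, softWeight β (-r) j *
    (softMax β (q j) + ∑ k, softWeight β (q j) k * (V j k - q j k) - r j)

/-- The slope of `softPlane` in the entry `V p.1 p.2`. -/
noncomputable def planeWeight (β : ℝ) (r : ι → ℝ) (q : ι → ι → ℝ) (p : ι × ι) : ℝ :=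
  softWeight β (-r) p.1 * softWeight β (q p.1) p.2

theorem softPlane_eq (β : ℝ) (r : ι → ℝ) (q V : ι → ι → ℝ) :
    softPlane β r q V = ∑ p, planeWeight β r q p * V p.1 p.2 + softPlane β r q 0 := by
  simp only [softPlane, planeWeight, Fintype.sum_prod_type, Pi.zero_apply, zero_sub, mul_assoc,
    ← Finset.mul_sum]
  rw [add_left_comm, ← Finset.sum_add_distrib]
  congr 1
  refine Finset.sum_congr rfl fun j _ => ?_
  simp only [mul_sub, mul_neg, Finset.sum_sub_distrib, Finset.sum_neg_distrib, mul_add]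
  ring

variable [Nonempty ι]

theorem sum_exp_pos (β : ℝ) (v : ι → ℝ) : 0 < ∑ i, Real.exp (β * v i) :=
  Finset.sum_pos (fun _ _ => Real.exp_pos _) Finset.univ_nonempty

theorem softWeight_nonneg (β : ℝ) (v : ι → ℝ) (i : ι) : 0 ≤ softWeight β v i :=
  div_nonneg (Real.exp_pos _).le (sum_exp_pos β v).le

theorem sum_softWeight (β : ℝ) (v : ι → ℝ) : ∑ i, softWeight β v i = 1 := by
  unfold softWeight
  rw [← Finset.sum_div, div_self (sum_exp_pos β v).ne']

/-- The smooth maximum is convex: it lies above its tangent planes. -/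
theorem softMax_add_sum_le {β : ℝ} (hβ : 0 < β) (q v : ι → ℝ) :
    softMax β q + ∑ i, softWeight β q i * (v i - q i) ≤ softMax β v := by
  have hq := sum_exp_pos β q
  have hv := sum_exp_pos β v
  have h1 := convexOn_exp.map_sum_le (t := Finset.univ) (w := softWeight β q)
    (p := fun i => β * (v i - q i)) (fun i _ => softWeight_nonneg β q i) (sum_softWeight β q)
    (fun i _ => mem_univ _)
  have h2 : ∑ i, softWeight β q i • Real.exp (β * (v i - q i)) =
      (∑ i, Real.exp (β * v i)) / ∑ i, Real.exp (β * q i) := by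
    rw [Finset.sum_div]
    refine Finset.sum_congr rfl fun i _ => ?_
    rw [softWeight, smul_eq_mul, div_mul_eq_mul_div, ← Real.exp_add]
    congr 2
    ring
  rw [h2, ← Real.le_log_iff_exp_le (by positivity), Real.log_div hv.ne' hq.ne'] at h1
  have h3 : ∑ i, softWeight β q i • (β * (v i - q i)) =
      β * ∑ i, softWeight β q i * (v i - q i) := by
    rw [Finset.mul_sum]
    exact Finset.sum_congr rfl fun i _ => by
      rw [smul_eq_mul]
      ring
  rw [h3] at h1
  unfold softMax
  have h4 := mul_le_mul_of_nonneg_left h1 (inv_nonneg.2 hβ.le)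
  rw [inv_mul_cancel_left₀ hβ.ne', mul_sub] at h4
  linarith

theorem le_softMax {β : ℝ} (hβ : 0 < β) {v : ι → ℝ} {m : ℝ} (h : ∃ i, m ≤ v i) :
    m ≤ softMax β v := by
  obtain ⟨i, hi⟩ := h
  refine hi.trans ?_
  have h1 : β * v i ≤ Real.log (∑ i, Real.exp (β * v i)) := by
    rw [Real.le_log_iff_exp_le (sum_exp_pos β v)]
    exact Finset.single_le_sum (f := fun i => Real.exp (β * v i)) (fun _ _ => (Real.exp_pos _).le)
      (Finset.mem_univ i)
  have h4 := mul_le_mul_of_nonneg_left h1 (inv_nonneg.2 hβ.le)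
  rwa [inv_mul_cancel_left₀ hβ.ne'] at h4

theorem softMax_le {β : ℝ} (hβ : 0 < β) {v : ι → ℝ} {m : ℝ} (h : ∀ i, v i ≤ m) :
    softMax β v ≤ m + Real.log (Fintype.card ι) / β := by
  have hcard : (0 : ℝ) < Fintype.card ι := by exact_mod_cast Fintype.card_pos
  have h1 : Real.log (∑ i, Real.exp (β * v i)) ≤ Real.log (Fintype.card ι) + β * m := by
    rw [← Real.log_exp (β * m), ← Real.log_mul hcard.ne' (Real.exp_pos _).ne']
    refine Real.log_le_log (sum_exp_pos β v) ?_
    calc _ ≤ ∑ _i : ι, Real.exp (β * m) := Finset.sum_le_sum fun i _ => by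
          have := h i
          gcongr
      _ = _ := by simp
  have h4 := mul_le_mul_of_nonneg_left h1 (inv_nonneg.2 hβ.le)
  rw [mul_add, inv_mul_cancel_left₀ hβ.ne'] at h4
  unfold softMax
  rw [div_eq_inv_mul]
  linarith

/-- For fixed `r` the supremum is attained at `q = V`, and then the infimum at
`r j = softMax β (V j)`. -/
theorem iInf_iSup_softPlane {β : ℝ} (hβ : 0 < β) (V : ι → ι → ℝ) :
    (⨅ r : ι → ℝ, ⨆ q : ι → ι → ℝ, (softPlane β r q V : EReal)) = softMinMax β V := by
  refine le_antisymm ?_ ?_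
  · refine (iInf_le _ fun j => softMax β (V j)).trans (iSup_le fun q => ?_)
    have : softPlane β (fun j => softMax β (V j)) q V ≤ softMinMax β V := by
      unfold softPlane softMinMax
      have h : ∑ j, softWeight β (-fun j => softMax β (V j)) j * (softMax β (q j) +
          ∑ k, softWeight β (q j) k * (V j k - q j k) - softMax β (V j)) ≤ 0 :=
        Finset.sum_nonpos fun j _ => mul_nonpos_of_nonneg_of_nonpos (softWeight_nonneg _ _ _)
          (by linarith [softMax_add_sum_le hβ (q j) (V j)])
      change -softMax β (-fun j => softMax β (V j)) + _ ≤ -softMax β (-fun j => softMax β (V j))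
      linarith
    exact_mod_cast this
  · refine le_iInf fun r => le_iSup_of_le V ?_
    have : softMinMax β V ≤ softPlane β r V V := by
      unfold softPlane softMinMax
      have h := softMax_add_sum_le hβ (-r) fun j => -softMax β (V j)
      have e : ∑ j, softWeight β (-r) j * (softMax β (V j) +
          ∑ k, softWeight β (V j) k * (V j k - V j k) - r j) =
          -∑ j, softWeight β (-r) j * (-softMax β (V j) - (-r) j) := by
        rw [← Finset.sum_neg_distrib]
        refine Finset.sum_congr rfl fun j _ => ?_
        simp only [sub_self, mul_zero, Finset.sum_const_zero, Pi.neg_apply]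
        ring
      rw [e]
      linarith
    exact_mod_cast this

theorem planeWeight_nonneg (β : ℝ) (r : ι → ℝ) (q : ι → ι → ℝ) (p : ι × ι) :
    0 ≤ planeWeight β r q p :=
  mul_nonneg (softWeight_nonneg _ _ _) (softWeight_nonneg _ _ _)

theorem sum_planeWeight (β : ℝ) (r : ι → ℝ) (q : ι → ι → ℝ) :
    ∑ p, planeWeight β r q p = 1 := by
  simp only [planeWeight, Fintype.sum_prod_type, ← Finset.mul_sum, sum_softWeight, mul_one]

theorem softMinMax_le {β : ℝ} (hβ : 0 < β) {V : ι → ι → ℝ} {m : ℝ} (h : ∃ j, ∀ k, V j k ≤ m) :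
    softMinMax β V ≤ m + Real.log (Fintype.card ι) / β := by
  obtain ⟨j, hj⟩ := h
  have := le_softMax hβ (v := fun j => -softMax β (V j)) ⟨j, neg_le_neg (softMax_le hβ hj)⟩
  unfold softMinMax
  linarith

theorem le_softMinMax {β : ℝ} (hβ : 0 < β) {V : ι → ι → ℝ} {m : ℝ} (h : ∀ j, ∃ k, m ≤ V j k) :
    m - Real.log (Fintype.card ι) / β ≤ softMinMax β V := by
  have := softMax_le hβ (v := fun j => -softMax β (V j)) fun j => neg_le_neg (le_softMax hβ (h j))
  unfold softMinMax
  linarith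

theorem contDiff_softMax {n : ℕ} (β : ℝ) {V : ι → Rn n → ℝ}
    (hV : ∀ i, ContDiff ℝ (⊤ : ℕ∞) (V i)) :
    ContDiff ℝ (⊤ : ℕ∞) fun x => softMax β fun i => V i x := by
  unfold softMax
  refine contDiff_const.mul (ContDiff.log (ContDiff.sum fun i _ => ?_)
    fun x => (sum_exp_pos β _).ne')
  exact (contDiff_const.mul (hV i)).exp

theorem contDiff_softMinMax {n : ℕ} (β : ℝ) {V : ι → ι → Rn n → ℝ}
    (hV : ∀ j k, ContDiff ℝ (⊤ : ℕ∞) (V j k)) :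
    ContDiff ℝ (⊤ : ℕ∞) fun x => softMinMax β fun j k => V j k x :=
  (contDiff_softMax β fun j => (contDiff_softMax β (hV j)).neg).neg

end Soft

/-! ### Smoothed inf-sup operators -/

section SoftOperator

variable {n : ℕ} {ι : Type} [Fintype ι]

/-- The operator `softMinMax` of the finitely many linear operators with kernels `K (j, k)` and zero
order terms `c (j, k)`, written as an inf-sup of convex combinations of these operators. -/
noncomputable def softOp (β : ℝ) (K : ι × ι → Rn n → Rn n → ℝ) (c : ι × ι → Rn n → ℝ) :
    InfSupOp.{0, 0} n where
  A := ι → ι → ℝ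
  B := ι → ℝ
  K q r x y := ∑ p, planeWeight β r q p * K p x y
  c q r x := ∑ p, planeWeight β r q p * c p x + softPlane β r q 0

variable [Nonempty ι] {β : ℝ} {K : ι × ι → Rn n → Rn n → ℝ} {c : ι × ι → Rn n → ℝ}

theorem softOp_eval (hβ : 0 < β) {u : Rn n → ℝ} {x : Rn n}
    (hint : ∀ p, Integrable fun y => secondDiff u x y * K p x y) :
    (softOp β K c).eval u x =
      (softMinMax β fun j k => -linOp (K (j, k)) u x + c (j, k) x : ℝ) := by
  rw [← iInf_iSup_softPlane hβ]
  have key : ∀ (r : ι → ℝ) (q : ι → ι → ℝ),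
      -linOp (fun x y => ∑ p, planeWeight β r q p * K p x y) u x +
        (∑ p, planeWeight β r q p * c p x + softPlane β r q 0) =
      softPlane β r q fun j k => -linOp (K (j, k)) u x + c (j, k) x := by
    intro r q
    have h1 : linOp (fun x y => ∑ p, planeWeight β r q p * K p x y) u x =
        ∑ p, planeWeight β r q p * linOp (K p) u x := by
      simp only [linOp_eq, Finset.mul_sum]
      have e : ∀ p y, secondDiff u x y * (planeWeight β r q p * K p x y) =
          planeWeight β r q p * (secondDiff u x y * K p x y) := fun p y => by ring
      simp only [e]
      rw [integral_finsetSum _ fun p _ => (hint p).const_mul _, Finset.mul_sum]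
      refine Finset.sum_congr rfl fun p _ => ?_
      rw [integral_const_mul]
      ring
    rw [h1]
    refine Eq.trans ?_ (softPlane_eq β r q _).symm
    simp only [mul_add, mul_neg, Finset.sum_add_distrib, Finset.sum_neg_distrib]
    ring
  exact iInf_congr fun r => iSup_congr fun q => congrArg _ (key r q)

theorem softOp_eval_zero (hβ : 0 < β) (x : Rn n) :
    (softOp β K c).eval (fun _ => 0) x = (softMinMax β fun j k => c (j, k) x : ℝ) := by
  have h0 : ∀ y, secondDiff (fun _ : Rn n => (0 : ℝ)) x y = 0 := fun y => by simp [secondDiff]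
  rw [softOp_eval hβ fun p => by simp only [h0, zero_mul]; exact integrable_zero _ _ _]
  simp only [linOp_eq, h0, zero_mul, integral_zero, mul_zero, neg_zero, zero_add]

theorem memIOmega_softOp {s lam Lam : ℝ} {ω : ℝ → ℝ} (hβ : 0 < β) (hω : ∀ a, 0 ≤ a → 0 ≤ ω a)
    (hK : ∀ p, MemLOmega s lam Lam ω (K p)) (hc : ∀ p x x', |c p x - c p x'| ≤ ω ‖x - x'‖)
    {M : ℝ} (hM : ∀ p x, |c p x| ≤ M) : MemIOmega s lam Lam ω (softOp β K c) := by
  refine ⟨fun q r => memLOmega_sum (planeWeight_nonneg β r q) (sum_planeWeight β r q) hω hK,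
    fun (q : ι → ι → ℝ) (r : ι → ℝ) x x' => ?_, M + Real.log (Fintype.card ι) / β, fun x => ?_⟩
  · have e : (softOp β K c).c q r x - (softOp β K c).c q r x' =
        ∑ p, planeWeight β r q p * (c p x - c p x') := by
      simp only [softOp, mul_sub, Finset.sum_sub_distrib]
      ring
    rw [e]
    calc _ ≤ ∑ p, |planeWeight β r q p * (c p x - c p x')| := Finset.abs_sum_le_sum_abs _ _
      _ ≤ ∑ p, planeWeight β r q p * ω ‖x - x'‖ := Finset.sum_le_sum fun p _ => by
        rw [abs_mul, abs_of_nonneg (planeWeight_nonneg β r q p)]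
        exact mul_le_mul_of_nonneg_left (hc p x x') (planeWeight_nonneg β r q p)
      _ = _ := by rw [← Finset.sum_mul, sum_planeWeight, one_mul]
  · rw [softOp_eval_zero hβ]
    constructor
    · have := le_softMinMax hβ (V := fun j k => c (j, k) x) (m := -M)
        fun j => ⟨j, (abs_le.1 (hM _ x)).1⟩
      exact_mod_cast (by linarith)
    · have := softMinMax_le hβ (V := fun j k => c (j, k) x) (m := M)
        ⟨Classical.arbitrary ι, fun k => (abs_le.1 (hM _ x)).2⟩
      exact_mod_cast this

theorem memIInfty_softOp {s lam Lam : ℝ} {ω : ℝ → ℝ} {C : ℕ → ℝ} (hs : 0 < s)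
    (hC : ∀ k, 0 ≤ C k) (hK : ∀ p, SmoothKernelBound s C (K p))
    (h : MemIOmega s lam Lam ω (softOp β K c)) : MemIInfty s lam Lam ω (softOp β K c) := by
  intro μ hμ
  obtain ⟨D, hD⟩ := SmoothKernelBound.exists_holderXBound n hs hC hμ
  exact ⟨h, D, fun q r => hD _ (smoothKernelBound_sum (planeWeight_nonneg β r q)
    (sum_planeWeight β r q) hK)⟩

end SoftOperator

/-! ### Estimates for the linear operators -/

section Estimates

variable {n : ℕ} {s Lam : ℝ}

theorem integrable_mul_of_trunc_bound {p C : ℝ} (hs : 0 < s) (hp : 2 * s < p)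
    {g k : Rn n → ℝ} (hgm : Measurable g) (hkm : Measurable k) (hg : ∀ y, |g y| ≤ C * trunc p y)
    (hk : ∀ y, |k y| ≤ Lam * fracKernel n s y) : Integrable fun y => g y * k y := by
  refine ((integrable_trunc_mul_fracKernel n hs hp).const_mul (C * Lam)).mono'
    (hgm.mul hkm).aestronglyMeasurable (Eventually.of_forall fun y => ?_)
  rw [norm_mul]
  calc _ ≤ (C * trunc p y) * (Lam * fracKernel n s y) :=
        mul_le_mul (hg y) (hk y) (abs_nonneg _) ((abs_nonneg _).trans (hg y))
    _ = _ := by ring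

theorem abs_integral_mul_le_of_lintegral_trunc {p C η : ℝ} (hC : 0 ≤ C) (hη : 0 ≤ η)
    {g k : Rn n → ℝ} (hg : ∀ y, |g y| ≤ C * trunc p y)
    (hk : ∫⁻ y, ENNReal.ofReal (trunc p y) * ‖k y‖ₑ ≤ ENNReal.ofReal η) :
    |∫ y, g y * k y| ≤ C * η := by
  have h : ‖∫ y, g y * k y‖ₑ ≤ ENNReal.ofReal (C * η) := by
    calc _ ≤ ∫⁻ y, ‖g y * k y‖ₑ := enorm_integral_le_lintegral_enorm _
      _ ≤ ∫⁻ y, ENNReal.ofReal C * (ENNReal.ofReal (trunc p y) * ‖k y‖ₑ) := by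
          refine lintegral_mono fun y => ?_
          rw [enorm_mul, ← mul_assoc, ← ENNReal.ofReal_mul hC]
          gcongr
          rw [← ofReal_norm]
          exact ENNReal.ofReal_le_ofReal (hg y)
      _ = ENNReal.ofReal C * ∫⁻ y, ENNReal.ofReal (trunc p y) * ‖k y‖ₑ :=
          lintegral_const_mul' _ _ ENNReal.ofReal_ne_top
      _ ≤ _ := by
          rw [ENNReal.ofReal_mul hC]
          gcongr
  rw [← ofReal_norm, ENNReal.ofReal_le_ofReal_iff (by positivity)] at h
  exact h

theorem exists_abs_secondDiff_le {u : Rn n → ℝ} (hu : ContDiff ℝ (⊤ : ℕ∞) u)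
    (hc : HasCompactSupport u) : ∃ C, 0 ≤ C ∧ ∀ x y, |secondDiff u x y| ≤ C * trunc 2 y := by
  obtain ⟨C, hC⟩ := exists_norm_iteratedFDeriv_secondDiff_le hu hc
  refine ⟨|C 0|, abs_nonneg _, fun x y => ?_⟩
  have := hC 0 x y
  rw [norm_iteratedFDeriv_zero] at this
  exact this.trans (mul_le_mul_of_nonneg_right (le_abs_self _) (trunc_nonneg _ _))

theorem abs_secondDiff_sub_le {u v : Rn n → ℝ} {σ : ℝ} {x x' : Rn n}
    (h : ∀ z, |u (x + z) - v (x' + z)| ≤ σ) (y : Rn n) :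
    |secondDiff u x y - secondDiff v x' y| ≤ 4 * σ := by
  have h0 := abs_le.1 (h 0)
  have h1 := abs_le.1 (h y)
  have h2 := abs_le.1 (h (-y))
  rw [add_zero, add_zero] at h0
  rw [← sub_eq_add_neg, ← sub_eq_add_neg] at h2
  unfold secondDiff
  rw [abs_le]
  constructor <;> linarith [h0.1, h0.2, h1.1, h1.2, h2.1, h2.2]

theorem exists_abs_linOp_le {u : Rn n → ℝ} (hs0 : 0 < s) (hs1 : s < 1) (Lam : ℝ)
    (hu : ContDiff ℝ (⊤ : ℕ∞) u) (hc : HasCompactSupport u) :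
    ∃ D : ℝ, ∀ K : Rn n → Rn n → ℝ, (∀ x y, |K x y| ≤ Lam * fracKernel n s y) →
      ∀ x, |linOp K u x| ≤ D := by
  obtain ⟨C, hC0, hC⟩ := exists_abs_secondDiff_le hu hc
  refine ⟨1 / 2 * ∫ y : Rn n, C * Lam * (trunc 2 y * fracKernel n s y), fun K hK x => ?_⟩
  rw [linOp_eq, abs_mul, abs_of_pos (by norm_num : (0 : ℝ) < 1 / 2)]
  refine mul_le_mul_of_nonneg_left ?_ (by norm_num)
  rw [← Real.norm_eq_abs]
  refine norm_integral_le_of_norm_le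
    ((integrable_trunc_mul_fracKernel n hs0 (by linarith)).const_mul _)
    (Eventually.of_forall fun y => ?_)
  rw [norm_mul]
  calc _ ≤ (C * trunc 2 y) * (Lam * fracKernel n s y) :=
        mul_le_mul (hC x y) (hK x y) (abs_nonneg _) ((abs_nonneg _).trans (hC x y))
    _ = _ := by ring

/-- For a test function `u` the functions `𝓛u` are equicontinuous, uniformly over the class of
kernels. -/
theorem exists_abs_linOp_sub_le {ω : ℝ → ℝ} (hω : IsModulus ω) {u : Rn n → ℝ} (hs0 : 0 < s)
    (hs1 : s < 1) (Lam : ℝ) (hu : ContDiff ℝ (⊤ : ℕ∞) u) (hc : HasCompactSupport u) {η : ℝ}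
    (hη : 0 < η) :
    ∃ τ > 0, ∀ K : Rn n → Rn n → ℝ, Measurable (Function.uncurry K) →
      (∀ x y, |K x y| ≤ Lam * fracKernel n s y) → HasModulusX s ω K →
      ∀ x x', ‖x - x'‖ < τ → |linOp K u x - linOp K u x'| ≤ η := by
  obtain ⟨C, hC0, hC⟩ := exists_abs_secondDiff_le hu hc
  have hp : 2 * s < 2 := by linarith
  obtain ⟨σ, hσ0, hσ⟩ := exists_abs_integral_le_of_small n hs0 hp (2 * C) Lam hη
  obtain ⟨τ₁, hτ₁, h₁⟩ := exists_lintegral_trunc_mul_sub_le (n := n) (Lam := Lam) hs0 hs1 hω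
    (show 0 < η / (C + 1) by positivity)
  have huc : UniformContinuous u := hc.uniformContinuous_of_continuous hu.continuous
  obtain ⟨τ₂, hτ₂, h₂⟩ := Metric.uniformContinuous_iff.1 huc (σ / 4) (by positivity)
  refine ⟨min τ₁ τ₂, lt_min hτ₁ hτ₂, fun K hm hK hmod x x' hxx => ?_⟩
  have hum := hu.continuous.measurable
  have a1 : |∫ y, (secondDiff u x y - secondDiff u x' y) * K x y| ≤ η := by
    refine hσ _ _ (fun y => ?_) (fun y => ?_) (hK x)
    · have := abs_sub (secondDiff u x y) (secondDiff u x' y)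
      linarith [hC x y, hC x' y]
    · refine (abs_secondDiff_sub_le (σ := σ / 4) (fun z => ?_) y).trans (by linarith)
      have := h₂ (a := x + z) (b := x' + z)
        (by simpa [dist_eq_norm] using hxx.trans_le (min_le_right _ _))
      exact (le_of_eq (Real.dist_eq _ _).symm).trans this.le
  have a2 : |∫ y, secondDiff u x' y * (K x y - K x' y)| ≤ η := by
    refine (abs_integral_mul_le_of_lintegral_trunc hC0 (by positivity) (hC x')
      (h₁ K hK hmod x x' (hxx.trans_le (min_le_left _ _)))).trans ?_
    rw [mul_div_assoc', div_le_iff₀ (by positivity)]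
    nlinarith
  have hint : ∀ z z', Integrable fun y => secondDiff u z y * K z' y := fun z z' =>
    integrable_mul_of_trunc_bound hs0 hp (measurable_secondDiff hum z) hm.of_uncurry_left (hC z)
      (hK z')
  have e : linOp K u x - linOp K u x' =
      1 / 2 * ((∫ y, (secondDiff u x y - secondDiff u x' y) * K x y) +
        ∫ y, secondDiff u x' y * (K x y - K x' y)) := by
    simp only [linOp_eq, sub_mul, mul_sub]
    rw [integral_sub (hint _ _) (hint _ _), integral_sub (hint _ _) (hint _ _)]
    ring
  rw [e, abs_mul, abs_of_pos (by norm_num : (0 : ℝ) < 1 / 2)]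
  linarith [abs_add_le (∫ y, (secondDiff u x y - secondDiff u x' y) * K x y)
    (∫ y, secondDiff u x' y * (K x y - K x' y))]

theorem exists_abs_linOp_smearKernel_sub_le {ω : ℝ → ℝ} (hω : IsModulus ω) {u : Rn n → ℝ}
    (hs0 : 0 < s) (hs1 : s < 1) (Lam : ℝ) (hu : ContDiff ℝ (⊤ : ℕ∞) u) (hc : HasCompactSupport u)
    {η : ℝ} (hη : 0 < η) :
    ∃ τ > 0, ∀ ρ ≤ τ, ∀ ψ : Rn n → ℝ, IsBump ψ ρ → ∀ K : Rn n → Rn n → ℝ,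
      Measurable (Function.uncurry K) →
      (∀ x y, |K x y| ≤ Lam * fracKernel n s y) → HasModulusX s ω K →
      ∀ x, |linOp (smearKernel ψ K) u x - linOp K u x| ≤ η := by
  obtain ⟨C, hC0, hC⟩ := exists_abs_secondDiff_le hu hc
  have hp : 2 * s < 2 := by linarith
  obtain ⟨τ, hτ, h⟩ := exists_lintegral_trunc_mul_sub_le (n := n) (Lam := Lam) hs0 hs1 hω
    (show 0 < η / (C + 1) by positivity)
  refine ⟨τ, hτ, fun ρ hρ ψ hψ K hm hK hmod x => ?_⟩
  have hum := hu.continuous.measurable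
  have a : |∫ y, secondDiff u x y * (smearKernel ψ K x y - K x y)| ≤ η := by
    refine (abs_integral_mul_le_of_lintegral_trunc hC0 (by positivity) (hC x)
      (lintegral_trunc_mul_smearKernel_sub_le hψ hm hK x fun z hz =>
        h K hK hmod (x - z) x (by simpa using hz.trans_le hρ))).trans ?_
    rw [mul_div_assoc', div_le_iff₀ (by positivity)]
    nlinarith
  have i1 : Integrable fun y => secondDiff u x y * K x y :=
    integrable_mul_of_trunc_bound hs0 hp (measurable_secondDiff hum x) hm.of_uncurry_left (hC x)
      (hK x)
  have i2 : Integrable fun y => secondDiff u x y * smearKernel ψ K x y :=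
    integrable_mul_of_trunc_bound hs0 hp (measurable_secondDiff hum x)
      (measurable_smearKernel hψ hm).of_uncurry_left (hC x) (abs_smearKernel_le hψ hm hK x)
  have e : linOp (smearKernel ψ K) u x - linOp K u x =
      1 / 2 * ∫ y, secondDiff u x y * (smearKernel ψ K x y - K x y) := by
    simp only [linOp_eq, mul_sub]
    rw [integral_sub i2 i1]
    ring
  rw [e, abs_mul, abs_of_pos (by norm_num : (0 : ℝ) < 1 / 2)]
  linarith [abs_nonneg (∫ y, secondDiff u x y * (smearKernel ψ K x y - K x y))]

end Estimates

/-! ### Mollification of the solution -/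

/-- Functions in `C^β`, `β > 2s`, have second differences of some order `p > 2s`. For `β > 2` this
exponent has to be `2` rather than `β`. -/
theorem HolderOn.exists_abs_secondDiff_le {n : ℕ} {s β : ℝ} (hs1 : s < 1)
    (hβ : 2 * s < β) {u : Rn n → ℝ} {V : Set (Rn n)} (hV : IsOpen V) (hconv : Convex ℝ V)
    (hu : HolderOn β u V) :
    ∃ p C : ℝ, 2 * s < p ∧ 0 ≤ C ∧ ∀ x y, x ∈ V → x + y ∈ V → x - y ∈ V →
      |secondDiff u x y| ≤ C * ‖y‖ ^ p := by
  obtain ⟨hreg, C, hbd, hhol⟩ := hu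
  have e2 : ∀ x y, |secondDiff u x y| = ‖u x + u x - u (x + y) - u (x - y)‖ := by
    intro x y
    rw [secondDiff, two_mul, Real.norm_eq_abs]
  have hdiff : ∀ m : ℕ, m ≠ 0 → m ≤ holderOrder β → ∀ z ∈ V, ContDiffAt ℝ m u z :=
    fun m _ hm z hz => (hreg.contDiffAt (hV.mem_nhds hz)).of_le (by exact_mod_cast hm)
  rcases Nat.lt_trichotomy (holderOrder β) 1 with hm | hm | hm
  · have hm0 : holderOrder β = 0 := by omega
    rw [hm0] at hhol
    refine ⟨β, 2 * |C|, hβ, by positivity, fun x y hx hxy hxy' => ?_⟩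
    have key : ∀ z ∈ V, |u x - u z| ≤ |C| * ‖x - z‖ ^ β := by
      intro z hz
      have := hhol x hx z hz
      simp only [iteratedFDeriv_zero_eq_comp, Function.comp_apply] at this
      rw [← map_sub, LinearIsometryEquiv.norm_map] at this
      simp only [Nat.cast_zero, sub_zero] at this
      refine this.trans ?_
      gcongr
      exact le_abs_self C
    have k1 := key _ hxy
    have k2 := key _ hxy'
    have a1 : x - (x + y) = -y := by abel
    have a2 : x - (x - y) = y := by abel
    rw [a1, norm_neg] at k1
    rw [a2] at k2
    have e : secondDiff u x y = (u x - u (x + y)) + (u x - u (x - y)) := by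
      unfold secondDiff
      ring
    rw [e]
    linarith [abs_add_le (u x - u (x + y)) (u x - u (x - y))]
  · rw [hm] at hhol
    have hm1 := hdiff 1 one_ne_zero hm.ge
    refine ⟨β, 2 * |C|, hβ, by positivity, fun x y hx hxy hxy' => ?_⟩
    have hβ1 : 0 ≤ β - 1 := by
      by_contra hneg
      have : holderOrder β = 0 := Nat.ceil_eq_zero.2 (by linarith)
      omega
    rw [e2]
    rcases eq_or_ne y 0 with rfl | hy
    · have : u x + u x - u (x + 0) - u (x - 0) = 0 := by
        rw [add_zero, sub_zero]
        ring
      rw [this, norm_zero]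
      positivity
    refine (norm_second_difference_le (A := |C| * ‖y‖ ^ (β - 1)) hconv
      (fun z hz => (hm1 z hz).differentiableAt (by simp)) hx hxy hxy'
      fun z hz hzy => ?_).trans_eq ?_
    · have := hhol z hz x hx
      have e3 : ‖fderiv ℝ u z - fderiv ℝ u x‖ =
          ‖iteratedFDeriv ℝ 1 u z - iteratedFDeriv ℝ 1 u x‖ := by
        have e4 : ∀ a, iteratedFDeriv ℝ 1 u a =
            (continuousMultilinearCurryFin1 ℝ (Rn n) ℝ).symm (fderiv ℝ u a) := by
          intro a
          ext v
          simp
        rw [e4, e4, ← map_sub, LinearIsometryEquiv.norm_map]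
      rw [e3]
      refine this.trans ?_
      simp only [Nat.cast_one]
      calc _ ≤ |C| * ‖z - x‖ ^ (β - 1) := by
            gcongr
            exact le_abs_self C
        _ ≤ _ := by gcongr
    · have hy0 : 0 < ‖y‖ := norm_pos_iff.2 hy
      have : ‖y‖ ^ β = ‖y‖ ^ (β - 1) * ‖y‖ := by
        rw [← Real.rpow_add_one hy0.ne']
        congr 1
        ring
      rw [this]
      ring
  · have hm2 := hdiff 2 two_ne_zero hm
    refine ⟨2, 2 * |C|, by linarith, by positivity, fun x y hx hxy hxy' => ?_⟩
    rw [e2]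
    refine (norm_second_difference_le (A := |C| * ‖y‖) hconv
      (fun z hz => (hm2 z hz).differentiableAt (by simp)) hx hxy hxy'
      fun z hz hzy => ?_).trans_eq ?_
    · have h1 : ‖fderiv ℝ u z - fderiv ℝ u x‖ ≤ |C| * ‖z - x‖ := by
        refine hconv.norm_image_sub_le_of_norm_fderiv_le (𝕜 := ℝ) (fun a ha => ?_)
          (fun a ha => ?_) hx hz
        · exact ((hm2 a ha).fderiv_right (m := 1) (by norm_num)).differentiableAt (by simp)
        · rw [← norm_iteratedFDeriv_one, norm_iteratedFDeriv_fderiv]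
          exact (hbd 2 hm a ha).trans (le_abs_self C)
      refine h1.trans ?_
      gcongr
    · rw [Real.rpow_two]
      ring

theorem secondDiff_smear {n : ℕ} {ψ u : Rn n → ℝ} {ρ M : ℝ} (hψ : IsBump ψ ρ)
    (hu : Measurable u) (hM : ∀ x, |u x| ≤ M) (x y : Rn n) :
    secondDiff (smear ψ u) x y = smear ψ (fun z => secondDiff u z y) x := by
  have hi := hψ.integrable_mul hu hM
  unfold smear secondDiff
  simp only [mul_sub]
  have e1 : ∀ z, x - z + y = x + y - z := fun z => by abel
  have e2 : ∀ z, x - z - y = x - y - z := fun z => by abel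
  have e3 : ∀ z, ψ z * (2 * u (x - z)) = 2 * (ψ z * u (x - z)) := fun z => by ring
  simp only [e1, e2, e3]
  have h1 : Integrable fun z => 2 * (ψ z * u (x - z)) - ψ z * u (x + y - z) :=
    ((hi x).const_mul 2).sub (hi _)
  rw [integral_sub h1 (hi _), integral_sub ((hi x).const_mul 2) (hi _), integral_const_mul]

theorem HolderCompact.continuous {n : ℕ} {δ : ℝ} {u : Rn n → ℝ} (hu : HolderCompact δ u) :
    Continuous u :=
  continuousOn_univ.1 hu.1.1.continuousOn

theorem HolderCompact.exists_abs_secondDiff_le_trunc {n : ℕ} {s δ β : ℝ} (hs0 : 0 < s)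
    (hs1 : s < 1) (hβ : 2 * s < β) {u : Rn n → ℝ} (hc : HolderCompact δ u)
    (hu : HolderLocOn β u (ball 0 1)) :
    ∃ p C : ℝ, 2 * s < p ∧ 0 ≤ C ∧ ∀ x ∈ ball (0 : Rn n) (7 / 8), ∀ y,
      |secondDiff u x y| ≤ C * trunc p y := by
  have hV : HolderOn β u (ball 0 (15 / 16)) := by
    refine hu _ isOpen_ball ?_ ?_
    · exact (isCompact_closedBall _ _).of_isClosed_subset isClosed_closure
        closure_ball_subset_closedBall
    · exact closure_ball_subset_closedBall.trans (closedBall_subset_ball (by norm_num))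
  obtain ⟨p, C, hp, hC0, hC⟩ := hV.exists_abs_secondDiff_le hs1 hβ isOpen_ball
    (convex_ball _ _)
  obtain ⟨M, hM⟩ := hc.2.exists_bound_of_continuous hc.continuous
  simp only [Real.norm_eq_abs] at hM
  have hM0 : 0 ≤ M := (abs_nonneg _).trans (hM 0)
  have hp0 : 0 < p := by linarith
  refine ⟨p, C + 4 * M * 16 ^ p, hp, by positivity, fun x hx y => ?_⟩
  rw [mem_ball_zero_iff] at hx
  have ht := trunc_nonneg p y
  rcases lt_or_ge ‖y‖ (1 / 16) with hy | hy
  · have h1 : trunc p y = ‖y‖ ^ p :=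
      min_eq_right (Real.rpow_le_one (norm_nonneg _) (by linarith) hp0.le)
    have h2 := hC x y (by rw [mem_ball_zero_iff]; linarith)
      (by rw [mem_ball_zero_iff]; linarith [norm_add_le x y])
      (by rw [mem_ball_zero_iff]; linarith [norm_sub_le x y])
    rw [← h1] at h2
    have : 0 ≤ 4 * M * 16 ^ p * trunc p y := by positivity
    linarith
  · have h1 : (1 / 16 : ℝ) ^ p ≤ trunc p y :=
      le_min (Real.rpow_le_one (by norm_num) (by norm_num) hp0.le)
        (Real.rpow_le_rpow (by norm_num) hy hp0.le)
    have h2 : |secondDiff u x y| ≤ 4 * M := by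
      have a := abs_le.1 (hM x)
      have b := abs_le.1 (hM (x + y))
      have c := abs_le.1 (hM (x - y))
      unfold secondDiff
      rw [abs_le]
      constructor <;> linarith [a.1, a.2, b.1, b.2, c.1, c.2]
    have h3 : (16 : ℝ) ^ p * (1 / 16 : ℝ) ^ p = 1 := by
      rw [← Real.mul_rpow (by norm_num) (by norm_num)]
      norm_num
    calc _ ≤ 4 * M * (16 ^ p * (1 / 16 : ℝ) ^ p) := by rw [h3]; linarith
      _ ≤ 4 * M * (16 ^ p * trunc p y) := by gcongr
      _ ≤ _ := by nlinarith [mul_nonneg hC0 ht]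

/-- `𝓛(u * φ_ε) → 𝓛 u` uniformly in `B_{3/4}` and over the class of kernels. Second differences of
`u * φ_ε` are averages of those of `u`, so they have the same decay at the origin, and they converge
uniformly to those of `u`. -/
theorem eventually_abs_linOp_mollify_sub_le {n : ℕ} {s δ β : ℝ} (hs0 : 0 < s)
    (hs1 : s < 1) (Lam : ℝ) (hβ : 2 * s < β) {u : Rn n → ℝ} (hc : HolderCompact δ u)
    (hu : HolderLocOn β u (ball 0 1)) {φ : Rn n → ℝ} (hφ : IsMollifier φ) {η : ℝ} (hη : 0 < η) :
    ∀ᶠ ε in 𝓝[>] (0 : ℝ), ∀ K : Rn n → Rn n → ℝ, Measurable (Function.uncurry K) →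
      (∀ x y, |K x y| ≤ Lam * fracKernel n s y) → ∀ x ∈ ball (0 : Rn n) (3 / 4),
        |linOp K (mollify φ u ε) x - linOp K u x| ≤ η := by
  obtain ⟨p, C, hp, hC0, hC⟩ := hc.exists_abs_secondDiff_le_trunc hs0 hs1 hβ hu
  obtain ⟨M, hM⟩ := hc.2.exists_bound_of_continuous hc.continuous
  simp only [Real.norm_eq_abs] at hM
  obtain ⟨σ, hσ0, hσ⟩ := exists_abs_integral_le_of_small n hs0 hp (2 * C) Lam hη
  have hum : Measurable u := hc.continuous.measurable
  have huc : UniformContinuous u := hc.2.uniformContinuous_of_continuous hc.continuous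
  obtain ⟨τ, hτ, h⟩ := Metric.uniformContinuous_iff.1 huc (σ / 4) (by positivity)
  have hmin : (0 : ℝ) < min τ (1 / 8) := lt_min hτ (by norm_num)
  filter_upwards [eventually_mem_nhdsWithin, mem_nhdsWithin_of_mem_nhds (Iio_mem_nhds hmin)]
    with ε hε0 hε K hm hK x hx
  have hε0 : 0 < ε := hε0
  have hε1 : ε < τ := lt_of_lt_of_le hε (min_le_left _ _)
  have hε2 : ε < 1 / 8 := lt_of_lt_of_le hε (min_le_right _ _)
  have hψ := hφ.isBump_rescale hε0
  rw [mollify_eq_smear]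
  set ψ := rescale φ ε
  rw [mem_ball_zero_iff] at hx
  have hsm : ∀ y, Measurable fun z => secondDiff u z y := fun y =>
    ((hum.const_mul 2).sub (hum.comp (measurable_id.add measurable_const))).sub
      (hum.comp (measurable_id.sub measurable_const))
  have hbd : ∀ z y, |secondDiff u z y| ≤ 4 * M := by
    intro z y
    have a := abs_le.1 (hM z)
    have b := abs_le.1 (hM (z + y))
    have c := abs_le.1 (hM (z - y))
    unfold secondDiff
    rw [abs_le]
    constructor <;> linarith [a.1, a.2, b.1, b.2, c.1, c.2]
  have b1 : ∀ y, |secondDiff u x y| ≤ C * trunc p y :=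
    fun y => hC x (by rw [mem_ball_zero_iff]; linarith) y
  have b2 : ∀ y, |secondDiff (smear ψ u) x y| ≤ C * trunc p y := by
    intro y
    rw [secondDiff_smear hψ hum hM]
    simpa using abs_smear_sub_le (c := 0) hψ (hsm y) (fun z => hbd z y) x fun z hz => by
      rw [sub_zero]
      refine hC _ ?_ y
      rw [mem_ball_zero_iff]
      linarith [norm_sub_le x z]
  have hsu : Measurable (smear ψ u) :=
    (contDiff_smear hψ (locallyIntegrable_of_bounded hum hM)).continuous.measurable
  have a : |∫ y, (secondDiff (smear ψ u) x y - secondDiff u x y) * K x y| ≤ η := by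
    refine hσ _ _ (fun y => ?_) (fun y => ?_) (hK x)
    · have := abs_sub (secondDiff (smear ψ u) x y) (secondDiff u x y)
      linarith [b1 y, b2 y]
    · refine (abs_secondDiff_sub_le (σ := σ / 4) (fun z => ?_) y).trans (by linarith)
      refine abs_smear_sub_le hψ hum hM _ fun a ha => ?_
      have := h (a := x + z - a) (b := x + z) (by
        rw [dist_eq_norm, sub_sub_cancel_left, norm_neg]
        exact ha.trans hε1)
      exact (le_of_eq (Real.dist_eq _ _).symm).trans this.le
  have e : linOp K (smear ψ u) x - linOp K u x =
      1 / 2 * ∫ y, (secondDiff (smear ψ u) x y - secondDiff u x y) * K x y := by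
    simp only [linOp_eq, sub_mul]
    rw [integral_sub
      (integrable_mul_of_trunc_bound hs0 hp (measurable_secondDiff hsu x) hm.of_uncurry_left b2
        (hK x))
      (integrable_mul_of_trunc_bound hs0 hp (measurable_secondDiff hum x) hm.of_uncurry_left b1
        (hK x))]
    ring
  rw [e, abs_mul, abs_of_pos (by norm_num : (0 : ℝ) < 1 / 2)]
  linarith [abs_nonneg (∫ y, (secondDiff (smear ψ u) x y - secondDiff u x y) * K x y)]

theorem hasCompactSupport_smear {n : ℕ} {ψ u : Rn n → ℝ} {ρ : ℝ} (hψ : IsBump ψ ρ)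
    (hu : HasCompactSupport u) : HasCompactSupport (smear ψ u) := by
  rw [← convolution_eq_smear]
  exact hu.convolution _ hψ.compact

/-! ### Zero order terms -/

theorem abs_smear_sub_smear_le {n : ℕ} {ψ g : Rn n → ℝ} {ρ M c : ℝ} (hψ : IsBump ψ ρ)
    (hg : Measurable g) (hM : ∀ x, |g x| ≤ M) (x x' : Rn n)
    (h : ∀ z, |g (x - z) - g (x' - z)| ≤ c) : |smear ψ g x - smear ψ g x'| ≤ c := by
  have e : smear ψ g x - smear ψ g x' = ∫ z, ψ z * (g (x - z) - g (x' - z)) := by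
    simp only [mul_sub]
    rw [integral_sub (hψ.integrable_mul hg hM x) (hψ.integrable_mul hg hM x')]
    rfl
  rw [e, ← Real.norm_eq_abs]
  calc _ ≤ ∫ z, ψ z * c := by
        refine norm_integral_le_of_norm_le (hψ.integrable.mul_const _)
          (Eventually.of_forall fun z => ?_)
        rw [norm_mul, Real.norm_of_nonneg (hψ.nonneg z)]
        exact mul_le_mul_of_nonneg_left (h z) (hψ.nonneg z)
    _ = c := by rw [integral_mul_const, hψ.integral_eq_one, one_mul]

theorem abs_clamp_sub_clamp_le (M a b : ℝ) :
    |max (-M) (min M a) - max (-M) (min M b)| ≤ |a - b| :=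
  (abs_max_sub_max_le_max _ _ _ _).trans (max_le (by simp)
    ((abs_min_sub_min_le_max _ _ _ _).trans (max_le (by simp) le_rfl)))

theorem IsModulus.exists_le {ω : ℝ → ℝ} (hω : IsModulus ω) {κ : ℝ} (hκ : 0 < κ) :
    ∃ τ > 0, ∀ t, 0 ≤ t → t < τ → ω t ≤ κ := by
  obtain ⟨τ, hτ0, hτ⟩ :=
    (mem_nhdsGT_iff_exists_Ioo_subset).1 (hω.tendsto_zero.eventually (gt_mem_nhds hκ))
  refine ⟨τ, hτ0, fun t ht0 ht => ?_⟩
  rcases ht0.eq_or_lt with rfl | h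
  · rw [hω.zero]
    exact hκ.le
  · exact le_of_lt (hτ ⟨h, ht⟩)

theorem IsModulus.continuous {n : ℕ} {ω : ℝ → ℝ} (hω : IsModulus ω) {g : Rn n → ℝ}
    (hg : ∀ x x', |g x - g x'| ≤ ω ‖x - x'‖) : Continuous g := by
  rw [Metric.continuous_iff]
  intro x κ hκ
  obtain ⟨τ, hτ0, hτ⟩ := hω.exists_le (half_pos hκ)
  refine ⟨τ, hτ0, fun x' hx' => ?_⟩
  rw [dist_eq_norm] at hx'
  have := (hg x' x).trans (hτ _ (norm_nonneg _) hx')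
  rw [Real.dist_eq]
  linarith

/-- Finitely many functions with modulus of continuity `ω` can be replaced by bounded smooth ones
with the same modulus, at a small cost in the unit ball. The functions need not be bounded on `ℝⁿ`,
so they are truncated before they are mollified. -/
theorem exists_smooth_approx_of_modulus {n : ℕ} {ι : Type} [Finite ι] {ω : ℝ → ℝ}
    (hω : IsModulus ω) {c : ι → Rn n → ℝ} (hc : ∀ p x x', |c p x - c p x'| ≤ ω ‖x - x'‖)
    {ψ : Rn n → ℝ} {ρ κ : ℝ} (hψ : IsBump ψ ρ) (hρ : ρ ≤ 1)
    (hκ : ∀ t, 0 ≤ t → t < ρ → ω t ≤ κ) :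
    ∃ (d : ι → Rn n → ℝ) (M : ℝ), (∀ p, ContDiff ℝ (⊤ : ℕ∞) (d p)) ∧
      (∀ p x x', |d p x - d p x'| ≤ ω ‖x - x'‖) ∧ (∀ p x, |d p x| ≤ M) ∧
      ∀ p, ∀ x ∈ ball (0 : Rn n) 1, |d p x - c p x| ≤ κ := by
  have hcont : ∀ p, Continuous (c p) := fun p => hω.continuous (hc p)
  have hb : ∀ p, ∃ M, ∀ x ∈ closedBall (0 : Rn n) 2, ‖c p x‖ ≤ M := fun p =>
    (isCompact_closedBall _ _).exists_bound_of_continuousOn (hcont p).continuousOn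
  choose M₀ hM₀ using hb
  obtain ⟨M₁, hM₁⟩ := (Set.finite_range M₀).bddAbove
  set M := max M₁ 0
  have hM0 : 0 ≤ M := le_max_right _ _
  have hM : ∀ p, ∀ x ∈ closedBall (0 : Rn n) 2, |c p x| ≤ M := fun p x hx =>
    (hM₀ p x hx).trans ((hM₁ (mem_range_self p)).trans (le_max_left _ _))
  let cc : ι → Rn n → ℝ := fun p x => max (-M) (min M (c p x))
  have hccm : ∀ p, Measurable (cc p) := fun p =>
    (continuous_const.max (continuous_const.min (hcont p))).measurable
  have hccM : ∀ p x, |cc p x| ≤ M := fun p x =>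
    abs_le.2 ⟨le_max_left _ _, max_le (by linarith) (min_le_left _ _)⟩
  refine ⟨fun p => smear ψ (cc p), M, fun p =>
    contDiff_smear hψ (locallyIntegrable_of_bounded (hccm p) (hccM p)), fun p x x' => ?_,
    fun p x => ?_, fun p x hx => ?_⟩
  · refine abs_smear_sub_smear_le hψ (hccm p) (hccM p) x x' fun z => ?_
    refine (abs_clamp_sub_clamp_le _ _ _).trans ((hc p _ _).trans_eq ?_)
    rw [sub_sub_sub_cancel_right]
  · simpa using abs_smear_sub_le (c := 0) hψ (hccm p) (hccM p) x
      fun z _ => by simpa using hccM p _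
  · refine abs_smear_sub_le hψ (hccm p) (hccM p) x fun z hz => ?_
    rw [mem_ball_zero_iff] at hx
    have h1 := abs_le.1 (hM p (x - z) (by
      rw [mem_closedBall_zero_iff]
      linarith [norm_sub_le x z]))
    have h2 : cc p (x - z) = c p (x - z) := by
      simp only [cc]
      rw [min_eq_right h1.2, max_eq_right h1.1]
    rw [h2]
    refine (hc p _ _).trans ?_
    rw [sub_sub_cancel_left, norm_neg]
    exact hκ _ (norm_nonneg _) hz

/-! ### Approximation of the nonlinear operator -/

theorem MemLOmega.abs_puncture_le {n : ℕ} {s lam Lam : ℝ} {ω : ℝ → ℝ} {K : Rn n → Rn n → ℝ}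
    (hs : 0 < s) (hlam : 0 < lam) (hK : MemLOmega s lam Lam ω K) (x y : Rn n) :
    |NonlocalApprox.puncture K x y| ≤ Lam * fracKernel n s y :=
  hK.puncture.1.abs_le hs hlam (fun x => by simp [NonlocalApprox.puncture]) x y

theorem linOp_fun_zero {n : ℕ} (K : Rn n → Rn n → ℝ) (x : Rn n) : linOp K (fun _ => 0) x = 0 := by
  simp [linOp]

/-- The value of the operator at a test function is finite. -/
theorem MemIOmega.exists_eval_eq {n : ℕ} {s lam Lam : ℝ} {ω : ℝ → ℝ} {I : InfSupOp.{v, w} n}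
    (hI : MemIOmega s lam Lam ω I) (hs0 : 0 < s) (hs1 : s < 1) (hlam : 0 < lam) {u : Rn n → ℝ}
    (hu : ContDiff ℝ (⊤ : ℕ∞) u) (hc : HasCompactSupport u) (x : Rn n) :
    ∃ t : ℝ, I.eval u x = t := by
  obtain ⟨D, hD⟩ := exists_abs_linOp_le hs0 hs1 Lam hu hc
  obtain ⟨M, hM⟩ := hI.bounded
  have hL : ∀ a b, |linOp (I.K a b) u x| ≤ D := fun a b => by
    rw [← linOp_puncture]
    exact hD _ ((hI.kernel a b).abs_puncture_le hs0 hlam) x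
  have h1 : I.eval u x ≤ ((M + D : ℝ) : EReal) :=
    iInf_iSup_coe_le_of_le (fun a b => by
      rw [linOp_fun_zero]
      linarith [(abs_le.1 (hL a b)).1]) (hM x).2
  have h2 : ((-M - D : ℝ) : EReal) ≤ I.eval u x :=
    coe_le_iInf_iSup_of_le (fun a b => by
      rw [linOp_fun_zero]
      linarith [(abs_le.1 (hL a b)).2]) (hM x).1
  exact ⟨(I.eval u x).toReal, (EReal.coe_toReal
    (h1.trans_lt (EReal.coe_lt_top _)).ne ((EReal.bot_lt_coe _).trans_le h2).ne').symm⟩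

/-- Finitely many inf-sup values are almost attained by finitely many members of the family: one
`b` for each value from above, and one `a` for each value and each of these `b` from below. -/
theorem exists_selection {A : Type v} {B : Type w} {L : Type} {V : L → A → B → ℝ} {t : L → ℝ}
    (hV : ∀ l, (⨅ b, ⨆ a, (V l a b : EReal)) = t l) {κ : ℝ} (hκ : 0 < κ) :
    ∃ (b : L → B) (a : L → L → A), (∀ l a', V l a' (b l) ≤ t l + κ) ∧
      ∀ j l, t l - κ ≤ V l (a j l) (b j) := by
  have h1 := fun l => iInf_iSup_coe_le_iff.1 (hV l).le κ hκ
  choose b hb using h1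
  have h2 := fun j l => coe_le_iInf_iSup_iff.1 (hV l).ge (b j) κ hκ
  choose a ha using h2
  exact ⟨b, a, hb, ha⟩

/-- An operator of the class can be approximated at finitely many test functions, uniformly in the
unit ball, by an operator with smooth data that maps each of them to a smooth function. -/
theorem MemIOmega.exists_smooth_approx {n : ℕ} {s lam Lam : ℝ} {ω : ℝ → ℝ} {I : InfSupOp.{v, w} n}
    (hI : MemIOmega s lam Lam ω I) (hs0 : 0 < s) (hs1 : s < 1) (hlam : 0 < lam)
    (hLam : lam ≤ Lam) (hω : IsModulus ω) {φ : Rn n → ℝ} (hφ : IsMollifier φ)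
    {S : Type} [Finite S] [Nonempty S] {u : S → Rn n → ℝ} (hu : ∀ σ, ContDiff ℝ (⊤ : ℕ∞) (u σ))
    (hc : ∀ σ, HasCompactSupport (u σ)) {η : ℝ} (hη : 0 < η) :
    ∃ (J : InfSupOp.{0, 0} n) (g : S → Rn n → ℝ), MemIOmega s lam Lam ω J ∧
      MemIInfty s lam Lam ω J ∧ (∀ σ, ContDiff ℝ (⊤ : ℕ∞) (g σ)) ∧
      (∀ σ x, J.eval (u σ) x = (g σ x : EReal)) ∧
      ∀ σ, ∀ x ∈ ball (0 : Rn n) 1, |g σ x - (I.eval (u σ) x).toReal| ≤ η := by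
  classical
  have := Fintype.ofFinite S
  set κ := η / 8 with hκ
  have hκ0 : 0 < κ := by positivity
  have hT : ∀ σ x, ∃ t : ℝ, I.eval (u σ) x = t := fun σ x =>
    hI.exists_eval_eq hs0 hs1 hlam (hu σ) (hc σ) x
  choose T hT using hT
  have hcl : ∀ a b, MemLOmega s lam Lam ω (puncture (I.K a b)) := fun a b => (hI.kernel a b).puncture
  have hbd : ∀ a b x y, |puncture (I.K a b) x y| ≤ Lam * fracKernel n s y :=
    fun a b => (hI.kernel a b).abs_puncture_le hs0 hlam
  -- Below the scale `τ` all oscillations in `x` are at most `κ`; it serves both as the mesh of the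
  -- net and as the radius of mollification.
  have h1 := fun σ => exists_abs_linOp_sub_le hω hs0 hs1 Lam (hu σ) (hc σ) hκ0
  choose τ₁ hτ₁ h1 using h1
  have h2 := fun σ => exists_abs_linOp_smearKernel_sub_le hω hs0 hs1 Lam (hu σ) (hc σ) hκ0
  choose τ₂ hτ₂ h2 using h2
  obtain ⟨τ₃, hτ₃, h3⟩ := hω.exists_le hκ0
  obtain ⟨τ, hτ0, hτ1, hτa, hτb, hτc⟩ : ∃ τ > 0, τ ≤ 1 ∧ (∀ σ, τ ≤ τ₁ σ) ∧ (∀ σ, τ ≤ τ₂ σ) ∧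
      τ ≤ τ₃ := by
    have hev : ∀ᶠ τ in 𝓝[>] (0 : ℝ), τ ≤ 1 ∧ (∀ σ, τ ≤ τ₁ σ) ∧ (∀ σ, τ ≤ τ₂ σ) ∧ τ ≤ τ₃ := by
      have hle : ∀ a : ℝ, 0 < a → ∀ᶠ τ in 𝓝[>] (0 : ℝ), τ ≤ a := fun a ha =>
        mem_nhdsWithin_of_mem_nhds (Iic_mem_nhds ha)
      exact (hle 1 one_pos).and ((eventually_all.2 fun σ => hle _ (hτ₁ σ)).and
        ((eventually_all.2 fun σ => hle _ (hτ₂ σ)).and (hle _ hτ₃)))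
    obtain ⟨τ, hτ, hτ0⟩ := (hev.and eventually_mem_nhdsWithin).exists
    exact ⟨τ, hτ0, hτ⟩
  have hψ := hφ.isBump_rescale hτ0
  set ψ := rescale φ τ
  obtain ⟨N, -, hNfin, hN⟩ := (isCompact_closedBall (0 : Rn n) 1).finite_cover_balls hτ0
  have := hNfin.fintype
  have hnet : ∀ x ∈ ball (0 : Rn n) 1, ∃ i : N, ‖x - i‖ < τ := by
    intro x hx
    obtain ⟨i, hi, hxi⟩ := mem_iUnion₂.1 (hN (ball_subset_closedBall hx))
    exact ⟨⟨i, hi⟩, by simpa [dist_eq_norm] using hxi⟩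
  have : Nonempty N := ⟨(hnet 0 (by simp)).choose⟩
  let L := N × S
  let V : S → Rn n → I.A → I.B → ℝ := fun σ x a b => -linOp (I.K a b) (u σ) x + I.c a b x
  have hVT : ∀ σ x, (⨅ b, ⨆ a, (V σ x a b : EReal)) = T σ x := hT
  have hVx : ∀ σ x x' a b, ‖x - x'‖ < τ → |V σ x a b - V σ x' a b| ≤ 2 * κ := by
    intro σ x x' a b hx
    have a1 := abs_le.1 (h1 σ _ (hcl a b).1.measurable (hbd a b) (hcl a b).2 x x'
      (hx.trans_le (hτa σ)))
    have a2 := abs_le.1 ((hI.modulus a b x x').trans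
      (h3 _ (norm_nonneg _) (hx.trans_le hτc)))
    rw [linOp_puncture] at a1
    simp only [V]
    rw [abs_le]
    constructor <;> linarith [a1.1, a1.2, a2.1, a2.2]
  obtain ⟨b, a, hb, ha⟩ := exists_selection (L := L) (V := fun l => V l.2 l.1)
    (t := fun l => T l.2 l.1) (fun l => hVT l.2 l.1) hκ0
  let K : L × L → Rn n → Rn n → ℝ := fun p => smearKernel ψ (puncture (I.K (a p.1 p.2) (b p.1)))
  obtain ⟨d, M, hd1, hd2, hd3, hd4⟩ := exists_smooth_approx_of_modulus (ι := L × L) hω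
    (c := fun p => I.c (a p.1 p.2) (b p.1)) (fun p => hI.modulus _ _) hψ hτ1
    (fun t ht0 ht => h3 t ht0 (ht.trans_le hτc))
  have hKcl : ∀ p, MemLOmega s lam Lam ω (K p) := fun p =>
    memLOmega_smearKernel hψ (hcl _ _) (hbd _ _)
  have hKbd : ∀ p x y, |K p x y| ≤ Lam * fracKernel n s y := fun p =>
    abs_smearKernel_le hψ (hcl _ _).1.measurable (hbd _ _)
  let C : ℕ → ℝ := fun k => Lam * ∫ z, ‖iteratedFDeriv ℝ k ψ z‖
  have hC0 : ∀ k, 0 ≤ C k := fun k =>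
    mul_nonneg (hlam.le.trans hLam) (integral_nonneg fun _ => norm_nonneg _)
  have hKC : ∀ p, SmoothKernelBound s C (K p) := fun p =>
    ⟨contDiff_smearKernel hψ (hcl _ _).1.measurable (hbd _ _),
      norm_iteratedFDeriv_smearKernel_le hψ (hcl _ _).1.measurable (hbd _ _)⟩
  -- The temperature is chosen so that `log (card L) / β ≤ κ`.
  have hlog : 0 ≤ Real.log (Fintype.card L) :=
    Real.log_nonneg (by exact_mod_cast Fintype.card_pos)
  set β := Real.log (Fintype.card L) / κ + 1 with hβ
  have hβ0 : 0 < β := by positivity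
  have hβκ : Real.log (Fintype.card L) / β ≤ κ := by
    rw [div_le_iff₀ hβ0, hβ, mul_add, mul_div_cancel₀ _ hκ0.ne']
    linarith
  have hmem : MemIOmega s lam Lam ω (softOp β K d) :=
    memIOmega_softOp hβ0 hω.nonneg hKcl hd2 hd3
  refine ⟨softOp β K d, fun σ x => softMinMax β fun j k => -linOp (K (j, k)) (u σ) x + d (j, k) x,
    hmem, memIInfty_softOp hs0 hC0 hKC hmem, fun σ => ?_, fun σ x => ?_, fun σ x hx => ?_⟩
  · exact contDiff_softMinMax β fun j k =>
      (contDiff_linOp hs0 hs1 (hKcl _).1.measurable (hKC _) (hu σ) (hc σ)).neg.add (hd1 _)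
  · obtain ⟨D, -, hD⟩ := exists_abs_secondDiff_le (hu σ) (hc σ)
    exact softOp_eval hβ0 fun p => integrable_mul_of_trunc_bound hs0 (by linarith)
      (measurable_secondDiff (hu σ).continuous.measurable x)
      (hKcl p).1.measurable.of_uncurry_left (hD x) (hKbd p x)
  · rw [hT, EReal.toReal_coe]
    obtain ⟨i, hi⟩ := hnet x hx
    have hTx := abs_le.1 (abs_sub_le_of_iInf_iSup_eq (fun a b => hVx σ x i a b hi)
      (hVT σ x) (hVT σ i))
    have hW : ∀ j k, |(-linOp (K (j, k)) (u σ) x + d (j, k) x) - V σ i (a j k) (b j)| ≤ 4 * κ := by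
      intro j k
      have a1 := abs_le.1 (h2 σ τ (hτb σ) ψ hψ _ (hcl (a j k) (b j)).1.measurable
        (hbd (a j k) (b j)) (hcl (a j k) (b j)).2 x)
      have a2 := abs_le.1 (hd4 (j, k) x hx)
      have a3 := abs_le.1 (hVx σ x i (a j k) (b j) hi)
      rw [linOp_puncture] at a1
      simp only [V, K] at a2 a3 ⊢
      rw [abs_le]
      constructor <;> linarith [a1.1, a1.2, a2.1, a2.2, a3.1, a3.2]
    -- The index `(i, σ)` of the selection is the one that controls the value at `(x, u σ)`.
    have up := softMinMax_le hβ0 (V := fun j k => -linOp (K (j, k)) (u σ) x + d (j, k) x)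
      (m := T σ i + 5 * κ) ⟨((i, σ) : L), fun k => by
        linarith [(abs_le.1 (hW (i, σ) k)).2, hb (i, σ) (a (i, σ) k)]⟩
    have low := le_softMinMax hβ0 (V := fun j k => -linOp (K (j, k)) (u σ) x + d (j, k) x)
      (m := T σ i - 5 * κ) fun j => ⟨((i, σ) : L), by
        linarith [(abs_le.1 (hW j (i, σ))).1, ha j (i, σ)]⟩
    have hη8 : η = 8 * κ := by
      rw [hκ]
      ring
    rw [hη8, abs_le]
    constructor <;> linarith [hTx.1, hTx.2]

end NonlocalApprox

open NonlocalApprox Metric Filter in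
theorem proposition5p1 {n : ℕ} (s lam Lam : ℝ) (hs0 : 0 < s) (hs1 : s < 1)
    (hlam : 0 < lam) (hLam : lam ≤ Lam)
    (ω : ℝ → ℝ) (hω : NonlocalApprox.IsModulus ω)
    (I : NonlocalApprox.InfSupOp.{v, w} n)
    (hIω : NonlocalApprox.MemIOmega s lam Lam ω I)
    (hI : NonlocalApprox.MemIInfty s lam Lam ω I)
    (δ : ℝ) (hδ : 0 < δ)
    (u : NonlocalApprox.Rn n → ℝ)
    (hu_loc : NonlocalApprox.HolderLocOn (2 * s + δ) u (Metric.ball 0 1))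
    (hu_cpt : NonlocalApprox.HolderCompact δ u)
    (f : NonlocalApprox.Rn n → ℝ) (hf : ContinuousOn f (Metric.ball 0 1))
    (hsol : ∀ x ∈ Metric.ball (0 : NonlocalApprox.Rn n) 1, I.eval u x = (f x : EReal))
    (φ : NonlocalApprox.Rn n → ℝ) (hφ : NonlocalApprox.IsMollifier φ) :
    ∃ (Ieps : ℝ → NonlocalApprox.InfSupOp.{0, 0} n) (feps : ℝ → NonlocalApprox.Rn n → ℝ),
      (∀ ε : ℝ, 0 < ε →
        NonlocalApprox.MemIOmega s lam Lam ω (Ieps ε) ∧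
        NonlocalApprox.MemIInfty s lam Lam ω (Ieps ε) ∧
        ContDiff ℝ (⊤ : ℕ∞) (NonlocalApprox.mollify φ u ε) ∧
        HasCompactSupport (NonlocalApprox.mollify φ u ε) ∧
        ContDiffOn ℝ (⊤ : ℕ∞) (feps ε) (Metric.ball 0 1) ∧
        ∀ x ∈ Metric.ball (0 : NonlocalApprox.Rn n) 1,
          (Ieps ε).eval (NonlocalApprox.mollify φ u ε) x = (feps ε x : EReal)) ∧
      TendstoUniformlyOn feps f (𝓝[>] 0) (Metric.ball 0 (3 / 4)) ∧
      TendstoUniformlyOn (fun ε x => ((Ieps ε).eval (fun _ => 0) x).toReal)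
        (fun x => (I.eval (fun _ => 0) x).toReal) (𝓝[>] 0) (Metric.ball 0 (3 / 4)) := by
  have hus : ∀ ε, 0 < ε → ContDiff ℝ (⊤ : ℕ∞) (mollify φ u ε) := fun ε hε => by
    rw [mollify_eq_smear]
    exact contDiff_smear (hφ.isBump_rescale hε) hu_cpt.continuous.locallyIntegrable
  have huc : ∀ ε, 0 < ε → HasCompactSupport (mollify φ u ε) := fun ε hε => by
    rw [mollify_eq_smear]
    exact hasCompactSupport_smear (hφ.isBump_rescale hε) hu_cpt.2
  let test : ℝ → Bool → Rn n → ℝ := fun ε σ => if σ then mollify φ u ε else fun _ => 0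
  have hJ : ∀ ε : ℝ, ∃ (J : InfSupOp.{0, 0} n) (g : Bool → Rn n → ℝ), 0 < ε →
      MemIOmega s lam Lam ω J ∧ MemIInfty s lam Lam ω J ∧
      (∀ σ, ContDiff ℝ (⊤ : ℕ∞) (g σ)) ∧ (∀ σ x, J.eval (test ε σ) x = (g σ x : EReal)) ∧
      ∀ σ, ∀ x ∈ ball (0 : Rn n) 1, |g σ x - (I.eval (test ε σ) x).toReal| ≤ ε := by
    intro ε
    rcases le_or_gt ε 0 with hε | hε
    -- Nothing is required for `ε ≤ 0`.
    · exact ⟨⟨PUnit, PUnit, 0, 0⟩, 0, fun h => absurd h hε.not_gt⟩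
    · have h1 : ∀ σ, ContDiff ℝ (⊤ : ℕ∞) (test ε σ) := by
        rintro (_ | _)
        · exact contDiff_const
        · exact hus ε hε
      have h2 : ∀ σ, HasCompactSupport (test ε σ) := by
        rintro (_ | _)
        · exact HasCompactSupport.zero
        · exact huc ε hε
      obtain ⟨J, g, h⟩ := hIω.exists_smooth_approx hs0 hs1 hlam hLam hω hφ h1 h2 hε
      exact ⟨J, g, fun _ => h⟩
  choose J g hJ using hJ
  have hball : ball (0 : Rn n) (3 / 4) ⊆ ball 0 1 := ball_subset_ball (by norm_num)
  refine ⟨J, fun ε => g ε true, fun ε hε => ?_, ?_, ?_⟩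
  · obtain ⟨h1, h2, h3, h4, -⟩ := hJ ε hε
    exact ⟨h1, h2, hus ε hε, huc ε hε, (h3 true).contDiffOn, fun x _ => h4 true x⟩
  · rw [Metric.tendstoUniformlyOn_iff]
    intro e he
    have hlt : ∀ᶠ ε in 𝓝[>] (0 : ℝ), ε < e / 2 :=
      mem_nhdsWithin_of_mem_nhds (Iio_mem_nhds (half_pos he))
    filter_upwards [hlt, eventually_mem_nhdsWithin,
      eventually_abs_linOp_mollify_sub_le hs0 hs1 Lam (show 2 * s < 2 * s + δ by linarith)
        hu_cpt hu_loc hφ (half_pos he)] with ε hε hε0 hlin x hx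
    have hε0 : 0 < ε := hε0
    obtain ⟨-, -, -, -, h5⟩ := hJ ε hε0
    obtain ⟨t, ht⟩ := hIω.exists_eval_eq hs0 hs1 hlam (hus ε hε0) (huc ε hε0) x
    have a1 : |g ε true x - t| ≤ ε := by
      have := h5 true x (hball hx)
      have ht' : I.eval (test ε true) x = t := ht
      rwa [ht', EReal.toReal_coe] at this
    have a2 : |t - f x| ≤ e / 2 := by
      refine abs_sub_le_of_iInf_iSup_eq (fun a b => ?_) ht (hsol x (hball hx))
      have := hlin _ (hIω.kernel a b).puncture.1.measurable
        ((hIω.kernel a b).abs_puncture_le hs0 hlam) x hx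
      rw [linOp_puncture, abs_sub_comm] at this
      convert this using 2
      ring
    rw [dist_comm, Real.dist_eq]
    calc _ ≤ |g ε true x - t| + |t - f x| := abs_sub_le _ _ _
      _ < e := by linarith
  · rw [Metric.tendstoUniformlyOn_iff]
    intro e he
    have hlt : ∀ᶠ ε in 𝓝[>] (0 : ℝ), ε < e := mem_nhdsWithin_of_mem_nhds (Iio_mem_nhds he)
    filter_upwards [hlt, eventually_mem_nhdsWithin] with ε hε hε0 x hx
    obtain ⟨-, -, -, h4, h5⟩ := hJ ε hε0
    have a1 := h5 false x (hball hx)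
    have a2 : (J ε).eval (fun _ => 0) x = g ε false x := h4 false x
    rw [a2, EReal.toReal_coe, dist_comm, Real.dist_eq]
    exact a1.trans_lt hε
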